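/- **Setting.** For an integer $p$ let $u=2^{-p}$ and $\mathbb F=\{0\}\cup\{M2^e: M,e\in\mathbb Z,\ 2^{p-1}\le |M|<2^p\}$ (binary floating point of precision $p$ with unbounded exponent range), and let $\mathrm{fl}:\mathbb R\to\mathbb F$ be any round-to-nearest map (arbitrary tie-breaking). The input is $\mathbf x_1,\mathbf x_2\in\mathbb F^3$ and $z_0\in\mathbb F$. Put $\mathbf n=\mathbf x_1\times\mathbf x_2=(n_x,n_y,n_z)$, $\mathbf n_{xy}=(n_x,n_y)$ and assume $n_x,n_y,n_z,z_0\ge 0$, $\|\mathbf x_1\|,\|\mathbf x_2\|\le B$ for a constant $B$ (the inputs represent points of the unit sphere, so $B\approx1$), and $\|\mathbf n_{xy}\|^2\ge\|\mathbf n\|^2z_0^2$, so that the great circle in the plane $\mathbf n^\perp$ meets the circle of latitude $z=z_0$ of the unit sphere. Let $s=\sqrt{\|\mathbf n_{xy}\|^2-\|\mathbf n\|^2z_0^2}$. The exact intersection point considered is $$\mathbf P=\Bigl(-\frac{z_0n_xn_z+s\,n_y}{\|\mathbf n_{xy}\|^2},\ -\frac{z_0n_yn_z-s\,n_x}{\|\mathbf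 n_{xy}\|^2},\ z_0\Bigr).$$ **Building blocks** (every $\mathrm{fl}$ is one floating-point instruction; pairs $[a,e]$ stand for $a+e$). - $\mathtt{TwoSum}(a,b)$: $x=\mathrm{fl}(a+b)$, $z=\mathrm{fl}(x-a)$; return $[x,\mathrm{fl}(\mathrm{fl}(a-\mathrm{fl}(x-z))+\mathrm{fl}(b-z))]$. - $\mathtt{FastTwoSum}(a,b)$: $x=\mathrm{fl}(a+b)$; return $[x,\mathrm{fl}(b-\mathrm{fl}(x-a))]$. - $\mathtt{TwoProd}(a,b)$: $x=\mathrm{fl}(ab)$; return $[x,\mathrm{fl}(ab-x)]$. - $\mathtt{CompDotC}(\mathbf x,\mathbf y)$: $[p,\sigma]=\mathtt{TwoProd}(x_0,y_0)$; for $i\ge1$: $[h,r]=\mathtt{TwoProd}(x_i,y_i)$, $[p,q]=\mathtt{TwoSum}(p,h)$, $\sigma=\mathrm{fl}(\sigma+\mathrm{fl}(q+r))$; return $[p,\sigma]$. $\mathtt{CompDot}$ returns $\mathrm{fl}(p+\sigma)$. - $\mathtt{AccuDOP}(a,b,c,d)$ (for $ad-bc$): $[p_1,r_1]=\mathtt{TwoProd}(a,d)$,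 $[p_2,r_2]=\mathtt{TwoProd}(b,c)$, $[q,t]=\mathtt{TwoSum}(p_1,-p_2)$; return $[q,\mathrm{fl}(t+\mathrm{fl}(r_1-r_2))]$. - $\mathtt{SumNonNeg}([A,a],[B,b])$: $[H,h]=\mathtt{TwoSum}(A,B)$; return $\mathtt{FastTwoSum}(H,\mathrm{fl}(h+\mathrm{fl}(a+b)))$. $\mathtt{SumOfSquares}(\mathbf x)$ adds the pairs $\mathtt{TwoProd}(x_j,x_j)$ successively to $[0,0]$ with $\mathtt{SumNonNeg}$. - $\mathtt{SumOfSquaresC}(\mathbf x,\mathbf e)$: $[S^*,s^*]=\mathtt{SumOfSquares}(\mathbf x)$; return $\mathtt{FastTwoSum}(S^*,\mathrm{fl}(2\,\mathtt{CompDot}(\mathbf x,\mathbf e)+s^*))$. - $\mathtt{AccSqrt}(T,t)$: no result if $T<0$; $[0,0]$ if $T=0$; otherwise $P=\mathrm{fl}(\sqrt T)$, $[H,h]=\mathtt{TwoProd}(P,P)$, $r=\mathrm{fl}(\mathrm{fl}(\mathrm{fl}(T-H)-h)+t)$; return $[P,\mathrm{fl}(r/\mathrm{fl}(2P))]$. **Algorithm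 AccuX.** With coordinates $\mathbf x_i=(x_i,y_i,z_i)$: 1. $[\bar n_x,e_x]=\mathtt{AccuDOP}(y_1,z_1,y_2,z_2)$, $[\bar n_y,e_y]=\mathtt{AccuDOP}(z_1,x_1,z_2,x_2)$, $[\bar n_z,e_z]=\mathtt{AccuDOP}(x_1,y_1,x_2,y_2)$. 2. $[S_2,s_2]=\mathtt{SumOfSquaresC}((\bar n_x,\bar n_y),(e_x,e_y))$, $[S_3,s_3]=\mathtt{SumOfSquaresC}((\bar n_x,\bar n_y,\bar n_z),(e_x,e_y,e_z))$. 3. $[C,e_C]=\mathtt{TwoProd}(z_0,z_0)$, $[D,e_D]=\mathtt{CompDotC}((S_3,S_3,s_3,s_3),(C,e_C,C,e_C))$, $[E,e_E]=\mathtt{TwoSum}(S_2,-D)$, $e=\mathrm{fl}(\mathrm{fl}(s_2-e_D)+e_E)$, $[T,t]=\mathtt{FastTwoSum}(E,e)$, $[\bar s,e_{\bar s}]=\mathtt{AccSqrt}(T,t)$. 4. For $w\in\{x,y\}$: $[F_w,f_w]=\mathtt{TwoProd}(\bar n_w,\bar n_z)$ and $e_{F_w}=\mathrm{fl}(\mathrm{fl}(f_w+\mathrm{fl}(\bar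 n_we_z))+\mathrm{fl}(\bar n_ze_w))$. 5. $X=\mathtt{CompDot}((F_x,e_{F_x},\bar n_y,e_y,\bar n_y,e_y),(z_0,z_0,\bar s,\bar s,e_{\bar s},e_{\bar s}))$ and $Y=\mathtt{CompDot}((F_y,e_{F_y},-\bar n_x,-e_x,-\bar n_x,-e_x),(z_0,z_0,\bar s,\bar s,e_{\bar s},e_{\bar s}))$. 6. Return $\tilde{\mathbf P}=(-\mathrm{fl}(X/S_2),-\mathrm{fl}(Y/S_2),z_0)$; there is no result if $\mathtt{AccSqrt}$ has none or $S_2=0$. **Theorem.** For every $B$ the following hold. *Regime (ii).* There is $K>0$, depending only on $B$, such that for every $\tilde c>0$ there is $p_0$ such that for all $p\ge p_0$, all round-to-nearest maps and all inputs as above with $$s>u^{1-\tilde c}$$ the algorithm returns a point $\tilde{\mathbf P}$, and $$\|\tilde{\mathbf P}-\mathbf P\|\le 3\sqrt{1-z_0^2}\;u+\frac{K}{s\,\|\mathbf n_{xy}\|}\,u^2,\qquad \|\tilde{\mathbf P}-\mathbf P\|\le 3u+\frac{K}{\|\mathbf n_{xy}\|}\,u^{1+\tilde c}.$$ So the error is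 at most $3\sqrt{1-z_0^2}\,u\le 3u$ to first order, with an input-independent coefficient. *Regime (i).* There are $K,L>0$, depending only on $B$, such that for all $p$, all round-to-nearest maps and all inputs as above with $\|\mathbf n_{xy}\|\ge L u$, and no condition on $s$: if $s\ge Lu$ the algorithm returns a result, and whenever it returns a result $\tilde{\mathbf P}$, $$\|\tilde{\mathbf P}-\mathbf P\|\le \frac{K}{\|\mathbf n_{xy}\|}\,u .$$ -/

import Mathlib

noncomputable section

namespace AccuX

/-! ### Binary floating point with unbounded exponent range -/

/-- The binary floating-point numbers of precision `p`. -/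
def floatSet (p : ℕ) : Set ℝ :=
  {x | x = 0 ∨ ∃ M e : ℤ, 2 ^ (p - 1) ≤ |M| ∧ |M| < 2 ^ p ∧ x = (M : ℝ) * (2 : ℝ) ^ e}

/-- The unit roundoff `u = 2⁻ᵖ`. -/
def unitRoundoff (p : ℕ) : ℝ := (2 : ℝ) ^ (-(p : ℤ))

/-- `fl` rounds every real number to a nearest element of `floatSet p`; ties are broken
arbitrarily. -/
def IsRoundToNearest (p : ℕ) (fl : ℝ → ℝ) : Prop :=
  ∀ t : ℝ, fl t ∈ floatSet p ∧ ∀ f ∈ floatSet p, |t - fl t| ≤ |t - f|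

/-! ### Floating-point building blocks

Every application of `fl` is one floating-point instruction: `+`, `-`, `*`, `/`, `√`, or a fused
multiply-add. A pair `(a, e)` stands for the unevaluated sum `a + e`. -/

/-- Knuth's `TwoSum`. -/
def twoSum (fl : ℝ → ℝ) (a b : ℝ) : ℝ × ℝ :=
  let x := fl (a + b)
  let z := fl (x - a)
  (x, fl (fl (a - fl (x - z)) + fl (b - z)))

/-- Dekker's `FastTwoSum`. -/
def fastTwoSum (fl : ℝ → ℝ) (a b : ℝ) : ℝ × ℝ :=
  let x := fl (a + b)
  (x, fl (b - fl (x - a)))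

/-- `TwoProd`, with the rounding error obtained from one fused multiply-add. -/
def twoProd (fl : ℝ → ℝ) (a b : ℝ) : ℝ × ℝ :=
  let x := fl (a * b)
  (x, fl (a * b - x))

/-- One pass through the loop of `CompDotC`: the state is `(p, s)`, the next pair of entries
is `ab`. -/
def compDotStep (fl : ℝ → ℝ) (ps ab : ℝ × ℝ) : ℝ × ℝ :=
  let hr := twoProd fl ab.1 ab.2
  let pq := twoSum fl ps.1 hr.1
  (pq.1, fl (ps.2 + fl (pq.2 + hr.2)))

/-- The composable compensated dot product `CompDotC`; the list holds the pairs `(xᵢ, yᵢ)`. -/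
def compDotC (fl : ℝ → ℝ) : List (ℝ × ℝ) → ℝ × ℝ
  | [] => (0, 0)
  | ab :: l => l.foldl (compDotStep fl) (twoProd fl ab.1 ab.2)

/-- The compensated dot product `CompDot`. -/
def compDot (fl : ℝ → ℝ) (l : List (ℝ × ℝ)) : ℝ :=
  fl ((compDotC fl l).1 + (compDotC fl l).2)

/-- `AccuDOP`: a compensated pair for the difference of products `a * d - b * c`. -/
def accuDOP (fl : ℝ → ℝ) (a b c d : ℝ) : ℝ × ℝ :=
  let pr₁ := twoProd fl a d
  let pr₂ := twoProd fl b c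
  let ds := twoSum fl pr₁.1 (-pr₂.1)
  (ds.1, fl (ds.2 + fl (pr₁.2 - pr₂.2)))

/-- `SumNonNeg`: the sum of two pairs. -/
def sumNonNeg (fl : ℝ → ℝ) (A B : ℝ × ℝ) : ℝ × ℝ :=
  let Hh := twoSum fl A.1 B.1
  fastTwoSum fl Hh.1 (fl (Hh.2 + fl (A.2 + B.2)))

/-- `SumOfSquares`. -/
def sumOfSquares (fl : ℝ → ℝ) (l : List ℝ) : ℝ × ℝ :=
  l.foldl (fun S x => sumNonNeg fl S (twoProd fl x x)) (0, 0)

/-- `SumOfSquaresC`: the sum of the squares of the entries `xⱼ + eⱼ`; the list holds the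
pairs `(xⱼ, eⱼ)`. -/
def sumOfSquaresC (fl : ℝ → ℝ) (l : List (ℝ × ℝ)) : ℝ × ℝ :=
  let S := sumOfSquares fl (l.map Prod.fst)
  fastTwoSum fl S.1 (fl (2 * compDot fl l + S.2))

/-- `AccSqrt`: the compensated square root of `T + t`. A negative radicand `T` gives no result;
`T = 0` gives `0`. -/
def accSqrt (fl : ℝ → ℝ) (T t : ℝ) : Option (ℝ × ℝ) :=
  if T < 0 then none
  else if T = 0 then some (0, 0)
  else
    let P := fl (√T)
    let Hh := twoProd fl P P
    let r := fl (fl (fl (T - Hh.1) - Hh.2) + t)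
    some (P, fl (r / fl (2 * P)))

/-- The compensated product of the pairs `a` and `b`, without the product of the two
compensation terms. -/
def pairProd (fl : ℝ → ℝ) (a b : ℝ × ℝ) : ℝ × ℝ :=
  let F := twoProd fl a.1 b.1
  (F.1, fl (fl (F.2 + fl (a.1 * b.2)) + fl (b.1 * a.2)))

/-- Algorithm `AccuX`. The result is the computed pair `(P̃ₓ, P̃ᵧ)`, or `none` if the run meets
the square root of a negative number or a division by zero. -/
def accuX (fl : ℝ → ℝ) (x₁ x₂ : EuclideanSpace ℝ (Fin 3)) (z₀ : ℝ) : Option (ℝ × ℝ) :=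
  let nx := accuDOP fl (x₁ 1) (x₁ 2) (x₂ 1) (x₂ 2)
  let ny := accuDOP fl (x₁ 2) (x₁ 0) (x₂ 2) (x₂ 0)
  let nz := accuDOP fl (x₁ 0) (x₁ 1) (x₂ 0) (x₂ 1)
  let S₂ := sumOfSquaresC fl [nx, ny]
  let S₃ := sumOfSquaresC fl [nx, ny, nz]
  let C := twoProd fl z₀ z₀
  let D := compDotC fl [(S₃.1, C.1), (S₃.1, C.2), (S₃.2, C.1), (S₃.2, C.2)]
  let E := twoSum fl S₂.1 (-D.1)
  let e := fl (fl (S₂.2 - D.2) + E.2)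
  let T := fastTwoSum fl E.1 e
  match accSqrt fl T.1 T.2 with
  | none => none
  | some s =>
    let Fx := pairProd fl nx nz
    let x := compDot fl
      [(Fx.1, z₀), (Fx.2, z₀), (ny.1, s.1), (ny.2, s.1), (ny.1, s.2), (ny.2, s.2)]
    let Fy := pairProd fl ny nz
    let y := compDot fl
      [(Fy.1, z₀), (Fy.2, z₀), (-nx.1, s.1), (-nx.2, s.1), (-nx.1, s.2), (-nx.2, s.2)]
    if S₂.1 = 0 then none else some (-fl (x / S₂.1), -fl (y / S₂.1))

/-! ### The exact intersection point -/

/-- The normal `n = x₁ × x₂` of the plane of the great circle. -/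
def normal (x₁ x₂ : EuclideanSpace ℝ (Fin 3)) : EuclideanSpace ℝ (Fin 3) :=
  WithLp.toLp 2 (crossProduct x₁.ofLp x₂.ofLp)

/-- The horizontal part `n_xy` of the normal. -/
def normalXY (x₁ x₂ : EuclideanSpace ℝ (Fin 3)) : EuclideanSpace ℝ (Fin 2) :=
  !₂[normal x₁ x₂ 0, normal x₁ x₂ 1]

/-- `s = √(‖n_xy‖² - ‖n‖² z₀²)`. -/
def sVal (x₁ x₂ : EuclideanSpace ℝ (Fin 3)) (z₀ : ℝ) : ℝ :=
  √(‖normalXY x₁ x₂‖ ^ 2 - ‖normal x₁ x₂‖ ^ 2 * z₀ ^ 2)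

/-- The exact intersection point of the great circle with the circle of latitude `z = z₀`
(of the two points, the one that `AccuX` computes). -/
def exactPoint (x₁ x₂ : EuclideanSpace ℝ (Fin 3)) (z₀ : ℝ) : EuclideanSpace ℝ (Fin 3) :=
  let n := normal x₁ x₂
  let s := sVal x₁ x₂ z₀
  !₂[-((z₀ * n 0 * n 2 + s * n 1) / ‖normalXY x₁ x₂‖ ^ 2),
    -((z₀ * n 1 * n 2 - s * n 0) / ‖normalXY x₁ x₂‖ ^ 2),
    z₀]

/-- `exactPoint` lies on the plane of the great circle, on the unit sphere, and at height `z₀`. -/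
theorem exactPoint_spec (x₁ x₂ : EuclideanSpace ℝ (Fin 3)) (z₀ : ℝ)
    (hn : normalXY x₁ x₂ ≠ 0)
    (hs : ‖normal x₁ x₂‖ ^ 2 * z₀ ^ 2 ≤ ‖normalXY x₁ x₂‖ ^ 2) :
    inner ℝ (normal x₁ x₂) (exactPoint x₁ x₂ z₀) = 0 ∧ ‖exactPoint x₁ x₂ z₀‖ = 1 ∧
      exactPoint x₁ x₂ z₀ 2 = z₀ := by
  have hs2 : sVal x₁ x₂ z₀ ^ 2 = ‖normalXY x₁ x₂‖ ^ 2 - ‖normal x₁ x₂‖ ^ 2 * z₀ ^ 2 :=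
    Real.sq_sqrt (by linarith)
  have hN0 : ‖normalXY x₁ x₂‖ ^ 2 ≠ 0 := by simpa using hn
  have hN : ‖normalXY x₁ x₂‖ ^ 2 = normal x₁ x₂ 0 ^ 2 + normal x₁ x₂ 1 ^ 2 := by
    simp [EuclideanSpace.norm_sq_eq, normalXY, Fin.sum_univ_two]
  have hM : ‖normal x₁ x₂‖ ^ 2 =
      normal x₁ x₂ 0 ^ 2 + normal x₁ x₂ 1 ^ 2 + normal x₁ x₂ 2 ^ 2 := by
    simp [EuclideanSpace.norm_sq_eq, Fin.sum_univ_three]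
  rw [hN, hM] at hs2
  rw [hN] at hN0
  refine ⟨?_, ?_, by simp [exactPoint]⟩
  · simp only [PiLp.inner_apply, Fin.sum_univ_three, exactPoint, hN]
    simp
    field_simp
    ring
  · have : ‖exactPoint x₁ x₂ z₀‖ ^ 2 = 1 := by
      simp only [EuclideanSpace.norm_sq_eq, Fin.sum_univ_three, exactPoint, hN,
        Real.norm_eq_abs, sq_abs]
      simp only [Matrix.cons_val_zero, Matrix.cons_val_one, Matrix.cons_val]
      field_simp
      generalize normal x₁ x₂ 0 = a at *
      generalize normal x₁ x₂ 1 = b at *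
      generalize normal x₁ x₂ 2 = c at *
      generalize sVal x₁ x₂ z₀ = s at *
      linear_combination (a ^ 2 + b ^ 2) * hs2
    nlinarith [norm_nonneg (exactPoint x₁ x₂ z₀)]

/-- The standing assumptions on the input: floating-point coordinates, nonnegative normal
components and height, the bound `B` on the lengths of `x₁` and `x₂`, and the condition
`‖n_xy‖² ≥ ‖n‖² z₀²` under which an intersection exists. -/
structure IsInput (p : ℕ) (B : ℝ) (x₁ x₂ : EuclideanSpace ℝ (Fin 3)) (z₀ : ℝ) : Prop where
  float₁ : ∀ i, x₁ i ∈ floatSet p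
  float₂ : ∀ i, x₂ i ∈ floatSet p
  float_z₀ : z₀ ∈ floatSet p
  norm₁ : ‖x₁‖ ≤ B
  norm₂ : ‖x₂‖ ≤ B
  normal_nonneg : ∀ i, 0 ≤ normal x₁ x₂ i
  z₀_nonneg : 0 ≤ z₀
  exists_inter : ‖normal x₁ x₂‖ ^ 2 * z₀ ^ 2 ≤ ‖normalXY x₁ x₂‖ ^ 2

end AccuX

end

/-!
The result rests on a first-order error analysis in which every bound is uniform over all precisions,
rounding maps and admissible inputs. These data form a type `Run B`; each computed or exact quantity
is a function on it, and a uniform bound is an `IsBigO` statement along a filter. The conditions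
`‖n_xy‖ ≥ L u` and `s ≥ L u`, with `L` large, are the filters `awayFromPole` (`‖n_xy‖ / u → ∞`) and
`transversal` (`s / u → ∞`), so that the constants `K` and `L` need not be tracked.

The building blocks take pairs that represent bounded quantities up to `O(u²)`, with a compensation
term of size `O(u)`, to pairs of the same kind (`Represents`). For `TwoProd` and `FastTwoSum` this
follows from the standard model `|fl t - t| ≤ u |t|` alone. `TwoSum` needs in addition that its third
operation is exact (`IsRoundToNearest.fl_sub_fl_sub`), which comes from Sterbenz' lemma. Hence the
pairs for `n`, `‖n_xy‖²` and `s²` have absolute errors `O(u²)`.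

If `s / u → ∞`, the compensated square root is one Newton step, and its error is `O(u² / s)`
(`root_sub_s_isBigO_of_transversal`). With no condition on `s` the error of the square root is still
`O(u)`: in `|√T - s| (√T + s) = |T - s²| = O(u s² + u²)` either `√T + s ≤ u`, or dividing by `√T + s`
gives the claim; and the compensation term of `T` is `O(u T)` even when `T` is the result of a
cancellation (`sqrt_T_sub_s_isBigO`, `Run.abs_T_snd_le`).

An error `O(h)` of the root yields an error `O(‖n_xy‖ h)` of the numerators before their last
rounding, hence `O(h / ‖n_xy‖)` after division by `‖n_xy‖²`. Only three roundings contribute to first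
order: those of the numerator, of the denominator `S₂` and of the quotient. They give a relative
error `3 u + O(u²)` in each coordinate, and the horizontal part of the exact point has length
`√(1 - z₀²)` (`exists_norm_sub_le`). The choices `h = u² / s` and `h = u` give the two regimes.
-/

namespace AccuX

open Filter Asymptotics Topology

/-! ### Floating-point numbers and rounding -/

theorem unitRoundoff_pos (p : ℕ) : 0 < unitRoundoff p := by
  unfold unitRoundoff; positivity

theorem unitRoundoff_le_one (p : ℕ) : unitRoundoff p ≤ 1 :=
  zpow_le_one_of_nonpos₀ one_le_two (by simp)

theorem zero_mem_floatSet (p : ℕ) : (0 : ℝ) ∈ floatSet p := Or.inl rfl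

theorem neg_mem_floatSet {p : ℕ} {x : ℝ} (hx : x ∈ floatSet p) : -x ∈ floatSet p := by
  rcases hx with rfl | ⟨M, e, h1, h2, rfl⟩
  · exact Or.inl (by simp)
  · exact Or.inr ⟨-M, e, by simpa using h1, by simpa using h2, by push_cast; ring⟩

theorem zpow_mul_mem_floatSet {p : ℕ} {x : ℝ} (k : ℤ) (hx : x ∈ floatSet p) :
    (2 : ℝ) ^ k * x ∈ floatSet p := by
  rcases hx with rfl | ⟨M, e, h1, h2, rfl⟩
  · exact Or.inl (by simp)
  · refine Or.inr ⟨M, k + e, h1, h2, ?_⟩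
    rw [zpow_add₀ two_ne_zero]; ring

theorem int_mul_zpow_mem_floatSet {p : ℕ} {M : ℤ} (e : ℤ) (hM : |M| < 2 ^ p) :
    (M : ℝ) * (2 : ℝ) ^ e ∈ floatSet p := by
  rcases eq_or_ne M 0 with rfl | h0
  · exact Or.inl (by simp)
  have hn0 : M.natAbs ≠ 0 := by simpa using h0
  have hlt : M.natAbs < 2 ^ p := by
    zify; exact hM
  have h1 : 2 ^ Nat.log 2 M.natAbs ≤ M.natAbs := Nat.pow_log_le_self 2 hn0
  have h2 : M.natAbs < 2 ^ (Nat.log 2 M.natAbs + 1) := Nat.lt_pow_succ_log_self one_lt_two _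
  have h3 : Nat.log 2 M.natAbs < p := Nat.log_lt_of_lt_pow hn0 hlt
  obtain ⟨n, hn⟩ : ∃ n, p = Nat.log 2 M.natAbs + 1 + n := ⟨p - (Nat.log 2 M.natAbs + 1), by omega⟩
  generalize Nat.log 2 M.natAbs = k at *
  zify at h1 h2
  refine Or.inr ⟨M * 2 ^ n, e - n, ?_, ?_, ?_⟩
  · rw [abs_mul, abs_of_pos (by positivity : (0 : ℤ) < 2 ^ n), hn,
      show k + 1 + n - 1 = k + n by omega, pow_add]
    gcongr
  · rw [abs_mul, abs_of_pos (by positivity : (0 : ℤ) < 2 ^ n), hn, pow_add]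
    gcongr
  · rw [zpow_sub₀ two_ne_zero]; push_cast; field_simp
    rw [zpow_natCast]

/-- Sterbenz' lemma: a sum of two floating-point numbers in which leading digits cancel is
exact. -/
theorem add_mem_floatSet_of_abs_le {p : ℕ} {x y : ℝ} (hx : x ∈ floatSet p) (hy : y ∈ floatSet p)
    (h1 : |x + y| ≤ |x|) (h2 : |x + y| ≤ |y|) : x + y ∈ floatSet p := by
  wlog hle : ∃ M e M' e' : ℤ, |M| < 2 ^ p ∧ x = (M : ℝ) * (2 : ℝ) ^ e ∧
      y = (M' : ℝ) * (2 : ℝ) ^ e' ∧ e ≤ e' generalizing x y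
  · rcases hx with rfl | ⟨M, e, ha, hb, hx'⟩
    · simpa using hy
    rcases hy with rfl | ⟨M', e', ha', hb', hy'⟩
    · exact Or.inr ⟨M, e, ha, hb, by simpa using hx'⟩
    rcases le_total e e' with he | he
    · exact absurd ⟨M, e, M', e', hb, hx', hy', he⟩ hle
    · rw [add_comm] at h1 h2 ⊢
      exact this (Or.inr ⟨M', e', ha', hb', hy'⟩) (Or.inr ⟨M, e, ha, hb, hx'⟩) h2 h1
        ⟨M', e', M, e, hb', hy', hx', he⟩
  obtain ⟨M, e, M', e', hM, rfl, rfl, he⟩ := hle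
  obtain ⟨n, rfl⟩ : ∃ n : ℕ, e' = e + n := ⟨(e' - e).toNat, by omega⟩
  have hsum : (M : ℝ) * 2 ^ e + M' * 2 ^ (e + n : ℤ) = ((M + M' * 2 ^ n : ℤ) : ℝ) * 2 ^ e := by
    rw [zpow_add₀ two_ne_zero, zpow_natCast]; push_cast; ring
  rw [hsum] at h1 ⊢
  apply int_mul_zpow_mem_floatSet
  have h2e : (0 : ℝ) < 2 ^ e := by positivity
  rw [abs_mul, abs_mul] at h1
  have := le_of_mul_le_mul_right h1 (abs_pos.2 h2e.ne')
  refine lt_of_le_of_lt ?_ hM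
  exact_mod_cast this

section

variable {p : ℕ} {fl : ℝ → ℝ}

theorem IsRoundToNearest.mem (h : IsRoundToNearest p fl) (t : ℝ) : fl t ∈ floatSet p := (h t).1

theorem IsRoundToNearest.fl_eq (h : IsRoundToNearest p fl) {f : ℝ} (hf : f ∈ floatSet p) :
    fl f = f := by
  have := (h f).2 f hf
  rw [sub_self, abs_zero] at this
  linarith [abs_eq_zero.1 (le_antisymm this (abs_nonneg _))]

theorem IsRoundToNearest.le_of_le (h : IsRoundToNearest p fl) {f t : ℝ} (hf : f ∈ floatSet p)
    (ht : t ≤ f) : fl t ≤ f := by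
  by_contra! hc
  have := (h t).2 f hf
  rw [abs_of_nonpos (by linarith), abs_of_nonpos (by linarith)] at this
  linarith

theorem IsRoundToNearest.ge_of_ge (h : IsRoundToNearest p fl) {f t : ℝ} (hf : f ∈ floatSet p)
    (ht : f ≤ t) : f ≤ fl t := by
  by_contra! hc
  have := (h t).2 f hf
  rw [abs_of_nonneg (by linarith), abs_of_nonneg (by linarith)] at this
  linarith

theorem exists_mem_floatSet_abs_sub_le (hp : 1 ≤ p) (t : ℝ) :
    ∃ f ∈ floatSet p, |t - f| ≤ unitRoundoff p * |t| := by
  rcases eq_or_ne t 0 with rfl | h0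
  · exact ⟨0, zero_mem_floatSet p, by simp⟩
  obtain ⟨e, he1, he2⟩ := exists_mem_Ico_zpow (abs_pos.2 h0) (one_lt_two (α := ℝ))
  set q : ℝ := 2 ^ (e + 1 - p : ℤ) with hq
  have hq0 : 0 < q := by positivity
  have hqp : q * 2 ^ p = 2 ^ (e + 1) := by
    rw [hq, ← zpow_natCast, ← zpow_add₀ two_ne_zero]; congr 1; ring
  have hqp1 : q * 2 ^ (p - 1) = 2 ^ e := by
    rw [hq, ← zpow_natCast, ← zpow_add₀ two_ne_zero]; congr 1; push_cast [hp]; ring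
  have hqu : q / 2 = unitRoundoff p * 2 ^ e := by
    rw [hq, unitRoundoff, ← zpow_add₀ two_ne_zero, div_eq_mul_inv,
      ← zpow_sub_one₀ (two_ne_zero' ℝ)]; congr 1; ring
  have hr : |t / q - round (t / q)| ≤ 1 / 2 := abs_sub_round _
  have hclose : |t - round (t / q) * q| ≤ unitRoundoff p * |t| := by
    have : t - round (t / q) * q = (t / q - round (t / q)) * q := by field_simp
    rw [this, abs_mul, abs_of_pos hq0]
    calc _ ≤ 1 / 2 * q := by gcongr
      _ = unitRoundoff p * 2 ^ e := by rw [← hqu]; ring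
      _ ≤ _ := by have := (unitRoundoff_pos p).le; gcongr
  refine ⟨round (t / q) * q, ?_, hclose⟩
  have habs : |t / q| = |t| / q := by rw [abs_div, abs_of_pos hq0]
  have hub : |t / q| < 2 ^ p := by rw [habs, div_lt_iff₀ hq0, mul_comm, hqp]; exact he2
  have hle : |round (t / q)| ≤ 2 ^ p := by
    have : |((round (t / q) : ℤ) : ℝ)| < 2 ^ p + 1 := by
      have := abs_sub_abs_le_abs_sub ((round (t / q) : ℤ) : ℝ) (t / q)
      rw [abs_sub_comm] at this
      linarith
    have h' : |round (t / q)| < 2 ^ p + 1 := by exact_mod_cast this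
    omega
  rcases hle.lt_or_eq with hlt | heq
  · exact int_mul_zpow_mem_floatSet _ hlt
  -- rounding up to the next power of two renormalizes the significand
  · have key : (2 : ℝ) ^ p * q ∈ floatSet p := by
      refine Or.inr ⟨2 ^ (p - 1), e + 1 - p + 1, ?_, ?_, ?_⟩
      · rw [abs_of_pos (by positivity)]
      · rw [abs_of_pos (by positivity)]
        exact pow_lt_pow_right₀ one_lt_two (by omega)
      · rw [zpow_add_one₀ two_ne_zero, ← hq]
        nth_rewrite 1 [show p = p - 1 + 1 by omega]
        rw [pow_succ]; push_cast; ring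
    rcases abs_eq (by positivity : (0 : ℤ) ≤ 2 ^ p) |>.1 heq with h | h
    · rw [h]; exact_mod_cast key
    · rw [h]; have := neg_mem_floatSet key; push_cast; rwa [neg_mul]

/-- The standard model of floating-point arithmetic. -/
theorem IsRoundToNearest.abs_sub_le (h : IsRoundToNearest p fl) (t : ℝ) :
    |fl t - t| ≤ unitRoundoff p * |t| := by
  rw [abs_sub_comm]
  rcases Nat.eq_zero_or_pos p with rfl | hp
  · simpa [unitRoundoff] using (h t).2 0 (zero_mem_floatSet _)
  · obtain ⟨f, hf, hft⟩ := exists_mem_floatSet_abs_sub_le hp t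
    exact ((h t).2 f hf).trans hft

theorem IsRoundToNearest.neg (h : IsRoundToNearest p fl) :
    IsRoundToNearest p (fun t => -fl (-t)) := by
  refine fun t => ⟨neg_mem_floatSet (h.mem _), fun f hf => ?_⟩
  have := (h (-t)).2 (-f) (neg_mem_floatSet hf)
  rwa [← abs_neg, ← abs_neg (t - f), show -(t - -fl (-t)) = -t - fl (-t) by ring,
    show -(t - f) = -t - -f by ring]

/-- Dekker's lemma, on which `FastTwoSum` rests. -/
theorem IsRoundToNearest.fl_add_sub_mem (h : IsRoundToNearest p fl) {a b : ℝ}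
    (ha : a ∈ floatSet p) (hb : b ∈ floatSet p) (hab : |b| ≤ |a|) :
    fl (a + b) - a ∈ floatSet p := by
  wlog ha0 : 0 ≤ a generalizing a b fl
  · have := neg_mem_floatSet (this h.neg (neg_mem_floatSet ha) (neg_mem_floatSet hb)
      (by simpa using hab) (by linarith))
    rw [show -(-a + -b) = a + b by ring] at this
    rwa [show fl (a + b) - a = -(-fl (a + b) - -a) by ring]
  rw [abs_of_nonneg ha0] at hab
  have hb' := abs_le.1 hab
  by_cases hc : |a + b| ≤ |b|
  · rw [h.fl_eq (add_mem_floatSet_of_abs_le ha hb (hc.trans (by rwa [abs_of_nonneg ha0])) hc)]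
    simpa using hb
  -- otherwise `a / 2 ≤ a + b ≤ 2 * a`, and both bounds survive rounding
  rw [abs_of_nonneg (by linarith), not_le, abs_lt] at hc
  have h1 : fl (a + b) ≤ 2 ^ (1 : ℤ) * a :=
    h.le_of_le (zpow_mul_mem_floatSet 1 ha) (by norm_num; linarith)
  have h2 : 2 ^ (-1 : ℤ) * a ≤ fl (a + b) :=
    h.ge_of_ge (zpow_mul_mem_floatSet (-1) ha) (by norm_num; linarith)
  norm_num at h1 h2
  rw [sub_eq_add_neg]
  apply add_mem_floatSet_of_abs_le (h.mem _) (neg_mem_floatSet ha)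
  · rw [abs_of_nonneg (by linarith : 0 ≤ fl (a + b)), abs_le]; constructor <;> linarith
  · rw [abs_neg, abs_of_nonneg ha0, abs_le]; constructor <;> linarith

/-- The third operation of `TwoSum` is exact; this is the only exactness property that the
accuracy of `TwoSum` needs. -/
theorem IsRoundToNearest.fl_sub_fl_sub (h : IsRoundToNearest p fl) {a b : ℝ}
    (ha : a ∈ floatSet p) (hb : b ∈ floatSet p) :
    fl (fl (a + b) - fl (fl (a + b) - a)) = fl (a + b) - fl (fl (a + b) - a) := by
  apply h.fl_eq
  rcases le_or_gt |a| |fl (a + b)| with hx | hx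
  · have := neg_mem_floatSet
      (h.fl_add_sub_mem (h.mem (a + b)) (neg_mem_floatSet ha) (by rwa [abs_neg]))
    rwa [neg_sub, ← sub_eq_add_neg] at this
  rcases le_or_gt |b| |a| with hba | hba
  · rw [h.fl_eq (h.fl_add_sub_mem ha hb hba)]
    simpa using ha
  · have h1 : |a + b| ≤ |a| := by
      by_contra! hc
      have hmem : |a| ∈ floatSet p := by
        rcases abs_choice a with h' | h' <;> rw [h']
        exacts [ha, neg_mem_floatSet ha]
      rcases lt_abs.1 hc with hc | hc
      · linarith [h.ge_of_ge hmem hc.le, le_abs_self (fl (a + b))]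
      · linarith [h.le_of_le (neg_mem_floatSet hmem) (by linarith : a + b ≤ -|a|),
          neg_abs_le (fl (a + b))]
    rw [h.fl_eq (add_mem_floatSet_of_abs_le ha hb h1 (h1.trans hba.le)), add_sub_cancel_left,
      h.fl_eq hb, add_sub_cancel_right]
    exact ha

end

/-! ### Runs of the algorithm and first-order rounding estimates -/

/-- A precision, a rounding map and an admissible input. Every quantity occurring in the
computation is a function on `Run B`, and a bound that is uniform in the precision, the rounding map
and the input is an `IsBigO` statement along a filter on `Run B`. -/
structure Run (B : ℝ) where
  /-- the precision -/
  p : ℕ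
  /-- the rounding map -/
  fl : ℝ → ℝ
  /-- the first input point -/
  x₁ : EuclideanSpace ℝ (Fin 3)
  /-- the second input point -/
  x₂ : EuclideanSpace ℝ (Fin 3)
  /-- the latitude -/
  z₀ : ℝ
  round : IsRoundToNearest p fl
  input : IsInput p B x₁ x₂ z₀

/-- The unit roundoff of a run. -/
noncomputable def Run.u {B : ℝ} (i : Run B) : ℝ := unitRoundoff i.p

variable {B : ℝ} {l : Filter (Run B)} {f g h v w a b α β : Run B → ℝ}

theorem Run.u_pos (i : Run B) : 0 < i.u := unitRoundoff_pos _

theorem Run.u_le_one (i : Run B) : i.u ≤ 1 := unitRoundoff_le_one _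

theorem Run.abs_fl_sub_le (i : Run B) (t : ℝ) : |i.fl t - t| ≤ i.u * |t| := i.round.abs_sub_le t

theorem u_isBigO_one : Run.u =O[l] fun _ => (1 : ℝ) :=
  .of_bound 1 (.of_forall fun i => by
    simpa [abs_of_pos i.u_pos] using i.u_le_one)

theorem u_sq_isBigO_u : (fun i => i.u ^ 2) =O[l] Run.u := by
  simpa [sq] using u_isBigO_one.mul (isBigO_refl (Run.u (B := B)) l)

theorem u_sq_isBigO_one : (fun i => i.u ^ 2) =O[l] fun _ => (1 : ℝ) :=
  u_sq_isBigO_u.trans u_isBigO_one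

theorem fl_sub_isBigO (hf : f =O[l] g) :
    (fun i => i.fl (f i) - f i) =O[l] fun i => i.u * g i :=
  (IsBigO.of_bound 1 (.of_forall fun i => by
    simpa [abs_of_pos i.u_pos] using i.abs_fl_sub_le (f i))).trans ((isBigO_refl Run.u l).mul hf)

theorem fl_isBigO (hf : f =O[l] g) : (fun i => i.fl (f i)) =O[l] g := by
  have h : (fun i => i.u * g i) =O[l] g := by
    simpa using u_isBigO_one.mul (isBigO_refl g l)
  simpa using ((fl_sub_isBigO hf).trans h).add hf

theorem fl_sub_isBigO_u (hf : f =O[l] fun _ => (1 : ℝ)) :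
    (fun i => i.fl (f i) - f i) =O[l] Run.u := by
  simpa using fl_sub_isBigO hf

theorem fl_sub_isBigO_u_sq (hf : f =O[l] Run.u)
    (hv : (fun i => f i - v i) =O[l] fun i => i.u ^ 2) :
    (fun i => i.fl (f i) - v i) =O[l] fun i => i.u ^ 2 := by
  have := fl_sub_isBigO hf
  simp only [← sq] at this
  simpa using this.add hv

theorem fl_sub_self_isBigO_u_sq (hf : f =O[l] Run.u) :
    (fun i => i.fl (f i) - f i) =O[l] fun i => i.u ^ 2 :=
  fl_sub_isBigO_u_sq hf (by simpa using isBigO_zero _ l)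

/-! ### Compensated pairs -/

/-- The pair `ab` represents the bounded quantity `v` up to `O(u²)`, with a leading part that is
bounded and a compensation term of size `O(u)`. -/
structure Represents (l : Filter (Run B)) (ab : Run B → ℝ × ℝ) (v : Run B → ℝ) : Prop where
  mem : ∀ i, (ab i).1 ∈ floatSet i.p
  fst : (fun i => (ab i).1) =O[l] fun _ => (1 : ℝ)
  snd : (fun i => (ab i).2) =O[l] Run.u
  err : (fun i => (ab i).1 + (ab i).2 - v i) =O[l] fun i => i.u ^ 2

variable {P Q : Run B → ℝ × ℝ}

theorem Represents.snd_one (hP : Represents l P v) :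
    (fun i => (P i).2) =O[l] fun _ => (1 : ℝ) := hP.snd.trans u_isBigO_one

theorem Represents.sum_one (hP : Represents l P v) :
    (fun i => (P i).1 + (P i).2) =O[l] fun _ => (1 : ℝ) := hP.fst.add hP.snd_one

theorem Represents.isBigO_one (hP : Represents l P v) : v =O[l] fun _ => (1 : ℝ) := by
  simpa using hP.sum_one.sub (hP.err.trans u_sq_isBigO_one)

theorem Represents.congr_err (hP : Represents l P v)
    (h : (fun i => v i - w i) =O[l] fun i => i.u ^ 2) : Represents l P w :=
  ⟨hP.mem, hP.fst, hP.snd, by simpa using hP.err.add h⟩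

theorem Represents.congr (hP : Represents l P v) (h : ∀ i, v i = w i) : Represents l P w := by
  rwa [show w = v from funext fun i => (h i).symm]

theorem Represents.neg (hP : Represents l P v) :
    Represents l (fun i => (-(P i).1, -(P i).2)) (fun i => -v i) :=
  ⟨fun i => neg_mem_floatSet (hP.mem i), hP.fst.neg_left, hP.snd.neg_left,
    hP.err.neg_left.congr_left fun i => by ring⟩

theorem Represents.mul_err (hP : Represents l P v) (hQ : Represents l Q w) :
    (fun i => ((P i).1 + (P i).2) * ((Q i).1 + (Q i).2) - v i * w i) =O[l] fun i => i.u ^ 2 := by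
  have h1 := hP.err.mul hQ.sum_one
  have h2 := hP.isBigO_one.mul hQ.err
  simp only [mul_one, one_mul] at h1 h2
  exact (h1.add h2).congr_left fun i => by ring

theorem represents_zero : Represents l (fun _ => (0, 0)) (fun _ => 0) :=
  ⟨fun i => zero_mem_floatSet _, isBigO_zero _ _, isBigO_zero _ _, by simpa using isBigO_zero _ l⟩

theorem represents_twoProd (ha : a =O[l] fun _ => (1 : ℝ)) (hb : b =O[l] fun _ => (1 : ℝ)) :
    Represents l (fun i => twoProd i.fl (a i) (b i)) (fun i => a i * b i) := by
  have hab : (fun i => a i * b i) =O[l] fun _ => (1 : ℝ) := by simpa using ha.mul hb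
  have h1 : (fun i => a i * b i - i.fl (a i * b i)) =O[l] Run.u :=
    (fl_sub_isBigO_u hab).neg_left.congr_left fun i => by ring
  exact ⟨fun i => i.round.mem _, fl_isBigO hab, fl_isBigO h1,
    (fl_sub_self_isBigO_u_sq h1).congr_left fun i => by simp only [twoProd]; ring⟩

theorem represents_twoSum (hma : ∀ i, a i ∈ floatSet i.p) (hmb : ∀ i, b i ∈ floatSet i.p)
    (ha : a =O[l] fun _ => (1 : ℝ)) (hb : b =O[l] fun _ => (1 : ℝ)) :
    Represents l (fun i => twoSum i.fl (a i) (b i)) (fun i => a i + b i) := by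
  have hx := fl_isBigO (ha.add hb)
  have h1 := fl_sub_isBigO_u (ha.add hb)
  have h2 := fl_sub_isBigO_u (hx.sub ha)
  -- with `d₁`, `d₂` the errors of the first two roundings, the last two operands are `d₂` and
  -- `-d₁ - d₂`
  have h3 : (fun i => a i - (i.fl (a i + b i) - i.fl (i.fl (a i + b i) - a i))) =O[l] Run.u :=
    h2.congr_left fun i => by ring
  have h4 : (fun i => b i - i.fl (i.fl (a i + b i) - a i)) =O[l] Run.u :=
    (h1.add h2).neg_left.congr_left fun i => by ring
  have h5 := (fl_isBigO h3).add (fl_isBigO h4)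
  have h6 := fl_sub_isBigO_u_sq h5 (v := fun i => a i + b i - i.fl (a i + b i))
    (((fl_sub_self_isBigO_u_sq h3).add (fl_sub_self_isBigO_u_sq h4)).congr_left fun i => by ring)
  have h7 : ∀ i, twoSum i.fl (a i) (b i) = (i.fl (a i + b i),
      i.fl (i.fl (a i - (i.fl (a i + b i) - i.fl (i.fl (a i + b i) - a i))) +
        i.fl (b i - i.fl (i.fl (a i + b i) - a i)))) := fun i => by
    simp only [twoSum, i.round.fl_sub_fl_sub (hma i) (hmb i)]
  simp only [h7]
  exact ⟨fun i => i.round.mem _, hx, fl_isBigO h5, h6.congr_left fun i => by ring⟩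

/-- No comparison of the operands is needed: if the second one is `O(u)`, the possible rounding
error of the intermediate difference is `O(u²)`. -/
theorem represents_fastTwoSum (ha : a =O[l] fun _ => (1 : ℝ)) (hb : b =O[l] Run.u) :
    Represents l (fun i => fastTwoSum i.fl (a i) (b i)) (fun i => a i + b i) := by
  have hab := ha.add (hb.trans u_isBigO_one)
  have h1 := fl_sub_isBigO_u hab
  have h2 : (fun i => i.fl (a i + b i) - a i) =O[l] Run.u :=
    (h1.add hb).congr_left fun i => by ring
  have h3 := fl_sub_self_isBigO_u_sq h2
  have h4 : (fun i => b i - i.fl (i.fl (a i + b i) - a i)) =O[l] Run.u := hb.sub (fl_isBigO h2)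
  exact ⟨fun i => i.round.mem _, fl_isBigO hab, fl_isBigO h4,
    ((fl_sub_self_isBigO_u_sq h4).sub h3).congr_left fun i => by simp only [fastTwoSum]; ring⟩

theorem Represents.compDotStep (hP : Represents l P v) (ha : a =O[l] fun _ => (1 : ℝ))
    (hb : b =O[l] fun _ => (1 : ℝ)) :
    Represents l (fun i => compDotStep i.fl (P i) (a i, b i)) (fun i => v i + a i * b i) := by
  have h1 := represents_twoProd ha hb
  have h2 := represents_twoSum hP.mem h1.mem hP.fst h1.fst
  have h3 := h2.snd.add h1.snd
  have h4 := hP.snd.add (fl_isBigO h3)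
  have h5 := fl_sub_isBigO_u_sq h4 (((fl_sub_self_isBigO_u_sq h3)).congr_left
    (f₂ := fun i => _ - ((P i).2 + (_ + _))) fun i => by rw [add_sub_add_left_eq_sub])
  refine ⟨h2.mem, h2.fst, fl_isBigO h4, (h5.add (h2.err.add (h1.err.add hP.err))).congr_left
    fun i => ?_⟩
  simp only [AccuX.compDotStep]
  ring

theorem fl_sub_isBigO_of_represents (hP : Represents l P v) (hv : v =O[l] Run.u) :
    (fun i => i.fl ((P i).1 + (P i).2) - v i) =O[l] fun i => i.u ^ 2 :=
  fl_sub_isBigO_u_sq (by simpa using (hP.err.trans u_sq_isBigO_u).add hv) hP.err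

variable {a' b' : Run B → ℝ}

theorem represents_accuDOP (ha : a =O[l] fun _ => (1 : ℝ)) (hb : b =O[l] fun _ => (1 : ℝ))
    (ha' : a' =O[l] fun _ => (1 : ℝ)) (hb' : b' =O[l] fun _ => (1 : ℝ)) :
    Represents l (fun i => accuDOP i.fl (a i) (b i) (a' i) (b' i))
      (fun i => a i * b' i - b i * a' i) := by
  have h1 := represents_twoProd ha hb'
  have h2 := represents_twoProd hb ha'
  have h3 := represents_twoSum h1.mem (fun i => neg_mem_floatSet (h2.mem i)) h1.fst
    h2.fst.neg_left
  have h4 := h1.snd.sub h2.snd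
  have h5 := h3.snd.add (fl_isBigO h4)
  have h6 := fl_sub_self_isBigO_u_sq h4
  have h7 := fl_sub_self_isBigO_u_sq h5
  refine ⟨h3.mem, h3.fst, fl_isBigO h5,
    (h7.add (h6.add (h3.err.add (h1.err.sub h2.err)))).congr_left fun i => ?_⟩
  simp only [accuDOP]
  ring

theorem Represents.sumNonNeg (hP : Represents l P v) (hQ : Represents l Q w) :
    Represents l (fun i => sumNonNeg i.fl (P i) (Q i)) (fun i => v i + w i) := by
  have h1 := represents_twoSum hP.mem hQ.mem hP.fst hQ.fst
  have h2 := hP.snd.add hQ.snd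
  have h3 := h1.snd.add (fl_isBigO h2)
  have h4 := represents_fastTwoSum h1.fst (fl_isBigO h3)
  refine h4.congr_err ((((fl_sub_self_isBigO_u_sq h3).add (fl_sub_self_isBigO_u_sq h2)).add
    (h1.err.add (hP.err.add hQ.err))).congr_left fun i => ?_)
  ring

/-- The last step of `SumOfSquaresC`, from `SumOfSquares` and from the dot product of the entries
with their compensation terms. The second conclusion concerns the argument of the rounding that
yields the leading part of the result. -/
theorem Represents.sumOfSquaresC {L : Run B → List (ℝ × ℝ)}
    (h1 : Represents l (fun i => sumOfSquares i.fl ((L i).map Prod.fst)) v)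
    (h2 : Represents l (fun i => compDotC i.fl (L i)) w) (hw : w =O[l] Run.u) :
    Represents l (fun i => sumOfSquaresC i.fl (L i)) (fun i => v i + 2 * w i) ∧
    (fun i => (sumOfSquares i.fl ((L i).map Prod.fst)).1 +
      i.fl (2 * compDot i.fl (L i) + (sumOfSquares i.fl ((L i).map Prod.fst)).2) -
        (v i + 2 * w i)) =O[l] fun i => i.u ^ 2 := by
  have h3 : (fun i => compDot i.fl (L i) - w i) =O[l] fun i => i.u ^ 2 :=
    fl_sub_isBigO_of_represents h2 hw
  have h4 : (fun i => compDot i.fl (L i)) =O[l] Run.u := by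
    simpa using (h3.trans u_sq_isBigO_u).add hw
  have h5 := (h4.const_mul_left 2).add h1.snd
  have h6 := ((fl_sub_self_isBigO_u_sq h5).add ((h3.const_mul_left 2).add h1.err)).congr_left
    (f₂ := fun i => (sumOfSquares i.fl ((L i).map Prod.fst)).1 +
      i.fl (2 * compDot i.fl (L i) + (sumOfSquares i.fl ((L i).map Prod.fst)).2) -
        (v i + 2 * w i)) fun i => by ring
  exact ⟨(represents_fastTwoSum h1.fst (fl_isBigO h5)).congr_err h6, h6⟩

theorem Represents.pairProd (hP : Represents l P v) (hQ : Represents l Q w) :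
    Represents l (fun i => pairProd i.fl (P i) (Q i)) (fun i => v i * w i) := by
  have h1 := represents_twoProd hP.fst hQ.fst
  have h2 : (fun i => (P i).1 * (Q i).2) =O[l] Run.u := by simpa using hP.fst.mul hQ.snd
  have h3 : (fun i => (Q i).1 * (P i).2) =O[l] Run.u := by simpa using hQ.fst.mul hP.snd
  have h4 := h1.snd.add (fl_isBigO h2)
  have h5 := (fl_isBigO h4).add (fl_isBigO h3)
  have h6 : (fun i => (P i).2 * (Q i).2) =O[l] fun i => i.u ^ 2 := by
    simpa [sq] using hP.snd.mul hQ.snd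
  refine ⟨h1.mem, h1.fst, fl_isBigO h5, ((((fl_sub_self_isBigO_u_sq h5).add
    ((fl_sub_self_isBigO_u_sq h4).add ((fl_sub_self_isBigO_u_sq h2).add
      (fl_sub_self_isBigO_u_sq h3)))).add (h1.err.add (hP.mul_err hQ))).sub h6).congr_left
        fun i => ?_⟩
  simp only [AccuX.pairProd]
  ring

/-! ### The exact quantities of a run -/

/-- The exact normal. -/
noncomputable def Run.n (i : Run B) : EuclideanSpace ℝ (Fin 3) := normal i.x₁ i.x₂

/-- The length of the horizontal part of the exact normal. -/
noncomputable def Run.N (i : Run B) : ℝ := ‖normalXY i.x₁ i.x₂‖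

/-- The exact square root `s`. -/
noncomputable def Run.s (i : Run B) : ℝ := sVal i.x₁ i.x₂ i.z₀

theorem Run.N_nonneg (i : Run B) : 0 ≤ i.N := norm_nonneg _

theorem Run.s_nonneg (i : Run B) : 0 ≤ i.s := Real.sqrt_nonneg _

theorem Run.N_sq (i : Run B) : i.N ^ 2 = i.n 0 ^ 2 + i.n 1 ^ 2 := by
  simp [Run.N, Run.n, EuclideanSpace.norm_sq_eq, normalXY, Fin.sum_univ_two]

theorem Run.s_sq (i : Run B) :
    i.s ^ 2 = i.n 0 ^ 2 + i.n 1 ^ 2 - (i.n 0 ^ 2 + i.n 1 ^ 2 + i.n 2 ^ 2) * i.z₀ ^ 2 := by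
  have h1 : i.s ^ 2 = ‖normalXY i.x₁ i.x₂‖ ^ 2 - ‖normal i.x₁ i.x₂‖ ^ 2 * i.z₀ ^ 2 :=
    Real.sq_sqrt (by linarith [i.input.exists_inter])
  have h2 : ‖normalXY i.x₁ i.x₂‖ ^ 2 = i.n 0 ^ 2 + i.n 1 ^ 2 := i.N_sq
  have h3 : ‖normal i.x₁ i.x₂‖ ^ 2 = i.n 0 ^ 2 + i.n 1 ^ 2 + i.n 2 ^ 2 := by
    simp [Run.n, EuclideanSpace.norm_sq_eq, Fin.sum_univ_three]
  rw [h1, h2, h3]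

theorem Run.s_le_N (i : Run B) : i.s ≤ i.N := by
  apply le_of_sq_le_sq _ i.N_nonneg
  rw [i.s_sq, i.N_sq]
  nlinarith [mul_nonneg (by positivity : 0 ≤ i.n 0 ^ 2 + i.n 1 ^ 2 + i.n 2 ^ 2) (sq_nonneg i.z₀)]

theorem Run.abs_n_le_N (i : Run B) : |i.n 0| ≤ i.N ∧ |i.n 1| ≤ i.N :=
  ⟨abs_le_of_sq_le_sq (by rw [i.N_sq]; nlinarith [sq_nonneg (i.n 1)]) i.N_nonneg,
    abs_le_of_sq_le_sq (by rw [i.N_sq]; nlinarith [sq_nonneg (i.n 0)]) i.N_nonneg⟩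

theorem Run.abs_z₀_le_one (i : Run B) (hN : 0 < i.N) : |i.z₀| ≤ 1 := by
  have h1 := i.s_sq
  have h2 := i.N_sq
  have h3 : 0 < i.N ^ 2 := by positivity
  rw [← sq_le_one_iff_abs_le_one]
  by_contra! hc
  nlinarith [sq_nonneg i.s, sq_nonneg (i.n 2), mul_nonneg (sq_nonneg (i.n 2)) (sq_nonneg i.z₀)]

/-- Along this filter, `‖n_xy‖ / u` tends to infinity. -/
noncomputable def awayFromPole (B : ℝ) : Filter (Run B) := comap (fun i => i.N / i.u) atTop

/-- Along this filter, `s / u` tends to infinity. -/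
noncomputable def transversal (B : ℝ) : Filter (Run B) := comap (fun i => i.s / i.u) atTop

theorem transversal_le : transversal B ≤ awayFromPole B :=
  map_le_iff_le_comap.1 <| tendsto_atTop_mono
    (fun i => div_le_div_of_nonneg_right i.s_le_N i.u_pos.le) tendsto_comap

theorem isLittleO_of_tendsto_div_u (hf : Tendsto (fun i => f i / i.u) l atTop) :
    Run.u =o[l] f := by
  refine (isLittleO_iff_tendsto' ?_).2 ?_
  · filter_upwards [hf.eventually_gt_atTop 0] with i hi h0
    simp [h0] at hi
  · exact hf.inv_tendsto_atTop.congr fun i => inv_div _ _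

theorem u_isLittleO_N (hl : l ≤ awayFromPole B) : Run.u =o[l] Run.N :=
  isLittleO_of_tendsto_div_u (tendsto_comap.mono_left hl)

theorem u_isLittleO_s (hl : l ≤ transversal B) : Run.u =o[l] Run.s :=
  isLittleO_of_tendsto_div_u (tendsto_comap.mono_left hl)

theorem eventually_N_pos (hl : l ≤ awayFromPole B) : ∀ᶠ i in l, 0 < i.N := by
  filter_upwards [(tendsto_comap.mono_left hl).eventually_gt_atTop 0] with i hi
  exact (div_pos_iff_of_pos_right i.u_pos).1 hi

theorem eventually_s_pos (hl : l ≤ transversal B) : ∀ᶠ i in l, 0 < i.s := by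
  filter_upwards [(tendsto_comap.mono_left hl).eventually_gt_atTop 0] with i hi
  exact (div_pos_iff_of_pos_right i.u_pos).1 hi

theorem coord_isBigO {x : Run B → EuclideanSpace ℝ (Fin 3)} (hx : ∀ i, ‖x i‖ ≤ B) (j : Fin 3) :
    (fun i => x i j) =O[l] fun _ => (1 : ℝ) :=
  .of_bound B (.of_forall fun i => by
    simpa using (PiLp.norm_apply_le (x i) j).trans (hx i))

theorem x₁_isBigO (j : Fin 3) : (fun i : Run B => i.x₁ j) =O[l] fun _ => (1 : ℝ) :=
  coord_isBigO (fun i => i.input.norm₁) j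

theorem x₂_isBigO (j : Fin 3) : (fun i : Run B => i.x₂ j) =O[l] fun _ => (1 : ℝ) :=
  coord_isBigO (fun i => i.input.norm₂) j

theorem Run.n_zero (i : Run B) : i.n 0 = i.x₁ 1 * i.x₂ 2 - i.x₁ 2 * i.x₂ 1 := by
  simp [Run.n, normal, cross_apply]

theorem Run.n_one (i : Run B) : i.n 1 = i.x₁ 2 * i.x₂ 0 - i.x₁ 0 * i.x₂ 2 := by
  simp [Run.n, normal, cross_apply]

theorem Run.n_two (i : Run B) : i.n 2 = i.x₁ 0 * i.x₂ 1 - i.x₁ 1 * i.x₂ 0 := by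
  simp [Run.n, normal, cross_apply]

theorem n_zero_isBigO_N : (fun i : Run B => i.n 0) =O[l] Run.N :=
  .of_bound 1 (.of_forall fun i => by simpa [abs_of_nonneg i.N_nonneg] using i.abs_n_le_N.1)

theorem n_one_isBigO_N : (fun i : Run B => i.n 1) =O[l] Run.N :=
  .of_bound 1 (.of_forall fun i => by simpa [abs_of_nonneg i.N_nonneg] using i.abs_n_le_N.2)

theorem s_isBigO_N : (Run.s (B := B)) =O[l] Run.N :=
  .of_bound 1 (.of_forall fun i => by
    simpa [abs_of_nonneg i.N_nonneg, abs_of_nonneg i.s_nonneg] using i.s_le_N)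

theorem z₀_isBigO_one (hl : l ≤ awayFromPole B) : (fun i => i.z₀) =O[l] fun _ => (1 : ℝ) :=
  .of_bound 1 (by
    filter_upwards [eventually_N_pos hl] with i hi
    simpa using i.abs_z₀_le_one hi)

/-! ### The computed quantities of a run -/

/-- The pair for `n_x`. -/
noncomputable def Run.nx (i : Run B) : ℝ × ℝ :=
  accuDOP i.fl (i.x₁ 1) (i.x₁ 2) (i.x₂ 1) (i.x₂ 2)

/-- The pair for `n_y`. -/
noncomputable def Run.ny (i : Run B) : ℝ × ℝ :=
  accuDOP i.fl (i.x₁ 2) (i.x₁ 0) (i.x₂ 2) (i.x₂ 0)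

/-- The pair for `n_z`. -/
noncomputable def Run.nz (i : Run B) : ℝ × ℝ :=
  accuDOP i.fl (i.x₁ 0) (i.x₁ 1) (i.x₂ 0) (i.x₂ 1)

/-- The pair for `‖n_xy‖²`. -/
noncomputable def Run.S₂ (i : Run B) : ℝ × ℝ := sumOfSquaresC i.fl [i.nx, i.ny]

/-- The real number whose rounding is the leading part of `S₂`. -/
noncomputable def Run.preS₂ (i : Run B) : ℝ :=
  (sumOfSquares i.fl [i.nx.1, i.ny.1]).1 +
    i.fl (2 * compDot i.fl [i.nx, i.ny] + (sumOfSquares i.fl [i.nx.1, i.ny.1]).2)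

/-- The pair for `‖n‖²`. -/
noncomputable def Run.S₃ (i : Run B) : ℝ × ℝ := sumOfSquaresC i.fl [i.nx, i.ny, i.nz]

/-- The pair for `‖n‖² z₀²`. -/
noncomputable def Run.D (i : Run B) : ℝ × ℝ :=
  compDotC i.fl [(i.S₃.1, (twoProd i.fl i.z₀ i.z₀).1), (i.S₃.1, (twoProd i.fl i.z₀ i.z₀).2),
    (i.S₃.2, (twoProd i.fl i.z₀ i.z₀).1), (i.S₃.2, (twoProd i.fl i.z₀ i.z₀).2)]

/-- The difference of the leading parts of `S₂` and `D`, with its rounding error. -/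
noncomputable def Run.E (i : Run B) : ℝ × ℝ := twoSum i.fl i.S₂.1 (-i.D.1)

/-- The compensation term of `s²`. -/
noncomputable def Run.e (i : Run B) : ℝ := i.fl (i.fl (i.S₂.2 - i.D.2) + i.E.2)

/-- The normalized pair for `s²`. -/
noncomputable def Run.T (i : Run B) : ℝ × ℝ := fastTwoSum i.fl i.E.1 i.e

/-- The computed residual of the square root. -/
noncomputable def Run.residual (i : Run B) : ℝ :=
  i.fl (i.fl (i.fl (i.T.1 - (twoProd i.fl (i.fl (√i.T.1)) (i.fl (√i.T.1))).1) -
    (twoProd i.fl (i.fl (√i.T.1)) (i.fl (√i.T.1))).2) + i.T.2)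

/-- The pair for `s`. For `T = 0` the division by zero makes it `(0, 0)`, as required by
`accSqrt`. -/
noncomputable def Run.root (i : Run B) : ℝ × ℝ :=
  (i.fl (√i.T.1), i.fl (i.residual / i.fl (2 * i.fl (√i.T.1))))

/-- The compensated dot product whose rounding is a numerator; `a` and `b` are the pairs for
`n_x, n_y` in the first numerator and for `n_y, -n_x` in the second. -/
noncomputable def Run.numer (i : Run B) (a b : ℝ × ℝ) : ℝ × ℝ :=
  compDotC i.fl [((pairProd i.fl a i.nz).1, i.z₀), ((pairProd i.fl a i.nz).2, i.z₀),
    (b.1, i.root.1), (b.2, i.root.1), (b.1, i.root.2), (b.2, i.root.2)]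

/-- The computed value of a coordinate, up to sign. -/
noncomputable def Run.coord (i : Run B) (a b : ℝ × ℝ) : ℝ :=
  i.fl (i.fl ((i.numer a b).1 + (i.numer a b).2) / i.S₂.1)

theorem Run.S₂_fst (i : Run B) : i.S₂.1 = i.fl i.preS₂ := rfl

theorem Run.T_fst (i : Run B) : i.T.1 = i.fl (i.E.1 + i.e) := rfl

theorem Run.fl_zero (i : Run B) : i.fl 0 = 0 := i.round.fl_eq (zero_mem_floatSet _)

theorem Run.accSqrt_eq (i : Run B) (hT : 0 ≤ i.T.1) :
    accSqrt i.fl i.T.1 i.T.2 = some i.root := by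
  rw [accSqrt, if_neg hT.not_gt]
  split_ifs with h0
  · simp [Run.root, h0, i.fl_zero]
  · rfl

theorem Run.accuX_eq_some (i : Run B) (hT : 0 ≤ i.T.1) (hS : i.S₂.1 ≠ 0) :
    accuX i.fl i.x₁ i.x₂ i.z₀ =
      some (-i.coord i.nx i.ny, -i.coord i.ny (-i.nx.1, -i.nx.2)) := by
  have h := i.accSqrt_eq hT
  unfold accuX
  simp only [Run.T, Run.e, Run.E, Run.D, Run.S₃, Run.S₂, Run.nx, Run.ny, Run.nz] at h hS
  simp only [h, if_neg hS]
  rfl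

theorem Run.T_nonneg_of_accuX_eq_some (i : Run B) {R : ℝ × ℝ}
    (hR : accuX i.fl i.x₁ i.x₂ i.z₀ = some R) : 0 ≤ i.T.1 := by
  by_contra! hT
  have h : accSqrt i.fl i.T.1 i.T.2 = none := by rw [accSqrt, if_pos hT]
  unfold accuX at hR
  simp only [Run.T, Run.e, Run.E, Run.D, Run.S₃, Run.S₂, Run.nx, Run.ny, Run.nz] at h
  simp only [h] at hR
  cases hR

/-! ### Accuracy of the normal and of `s²` -/

theorem represents_nx : Represents l Run.nx fun i : Run B => i.n 0 :=
  (represents_accuDOP (x₁_isBigO 1) (x₁_isBigO 2) (x₂_isBigO 1) (x₂_isBigO 2)).congr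
    fun i => i.n_zero.symm

theorem represents_ny : Represents l Run.ny fun i : Run B => i.n 1 :=
  (represents_accuDOP (x₁_isBigO 2) (x₁_isBigO 0) (x₂_isBigO 2) (x₂_isBigO 0)).congr
    fun i => i.n_one.symm

theorem represents_nz : Represents l Run.nz fun i : Run B => i.n 2 :=
  (represents_accuDOP (x₁_isBigO 0) (x₁_isBigO 1) (x₂_isBigO 0) (x₂_isBigO 1)).congr
    fun i => i.n_two.symm

theorem N_isBigO_one : Run.N (B := B) =O[l] fun _ => (1 : ℝ) := by
  have h := (represents_nx (l := l) (B := B)).isBigO_one.norm_left.add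
    (represents_ny (l := l)).isBigO_one.norm_left
  refine (IsBigO.of_bound 1 (.of_forall fun i => ?_)).trans h
  have h0 := abs_nonneg (i.n 0)
  have h1 := abs_nonneg (i.n 1)
  simp only [Real.norm_eq_abs, one_mul, abs_of_nonneg i.N_nonneg, abs_of_nonneg (add_nonneg h0 h1)]
  apply le_of_sq_le_sq _ (by positivity)
  rw [i.N_sq, ← sq_abs (i.n 0), ← sq_abs (i.n 1)]
  nlinarith

theorem s_isBigO_one : Run.s (B := B) =O[l] fun _ => (1 : ℝ) := s_isBigO_N.trans N_isBigO_one

/-- The square of the compensated sum exceeds what `SumOfSquaresC` computes by the square of the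
compensation term, which is `O(u²)`. -/
theorem Represents.sq_sub_isBigO (hP : Represents l P v) :
    (fun i => (P i).1 * (P i).1 + 2 * ((P i).1 * (P i).2) - v i ^ 2) =O[l] fun i => i.u ^ 2 := by
  have h1 : (fun i => (P i).2 * (P i).2) =O[l] fun i => i.u ^ 2 := by
    simpa [sq] using hP.snd.mul hP.snd
  exact ((hP.mul_err hP).sub h1).congr_left fun i => by ring

theorem Represents.mul_isBigO_u (hP : Represents l P v) :
    (fun i => (P i).1 * (P i).2) =O[l] Run.u := by
  simpa using hP.fst.mul hP.snd

theorem S₂_aux :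
    Represents l Run.S₂ (fun i : Run B => i.n 0 ^ 2 + i.n 1 ^ 2) ∧
    (fun i : Run B => i.preS₂ - (i.n 0 ^ 2 + i.n 1 ^ 2)) =O[l] fun i => i.u ^ 2 := by
  have hx := represents_nx (l := l) (B := B)
  have hy := represents_ny (l := l) (B := B)
  have h1 := (represents_zero.sumNonNeg (represents_twoProd hx.fst hx.fst)).sumNonNeg
    (represents_twoProd hy.fst hy.fst)
  have h2 := (represents_twoProd hx.fst hx.snd_one).compDotStep hy.fst hy.snd_one
  obtain ⟨h3, h4⟩ := Represents.sumOfSquaresC (L := fun i => [i.nx, i.ny]) h1 h2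
    (hx.mul_isBigO_u.add hy.mul_isBigO_u)
  have h5 := (hx.sq_sub_isBigO.add hy.sq_sub_isBigO).congr_left (f₂ := fun i =>
    0 + i.nx.1 * i.nx.1 + i.ny.1 * i.ny.1 + 2 * (i.nx.1 * i.nx.2 + i.ny.1 * i.ny.2) -
      (i.n 0 ^ 2 + i.n 1 ^ 2)) fun i => by ring
  exact ⟨h3.congr_err h5, (h4.add h5).congr_left fun i => sub_add_sub_cancel _ _ _⟩

theorem represents_S₂ : Represents l Run.S₂ (fun i : Run B => i.n 0 ^ 2 + i.n 1 ^ 2) := S₂_aux.1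

theorem preS₂_sub_isBigO : (fun i : Run B => i.preS₂ - i.N ^ 2) =O[l] fun i => i.u ^ 2 := by
  simpa only [Run.N_sq] using S₂_aux.2

theorem represents_S₃ :
    Represents l Run.S₃ (fun i : Run B => i.n 0 ^ 2 + i.n 1 ^ 2 + i.n 2 ^ 2) := by
  have hx := represents_nx (l := l) (B := B)
  have hy := represents_ny (l := l) (B := B)
  have hz := represents_nz (l := l) (B := B)
  have h1 := ((represents_zero.sumNonNeg (represents_twoProd hx.fst hx.fst)).sumNonNeg
    (represents_twoProd hy.fst hy.fst)).sumNonNeg (represents_twoProd hz.fst hz.fst)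
  have h2 := ((represents_twoProd hx.fst hx.snd_one).compDotStep hy.fst hy.snd_one).compDotStep
    hz.fst hz.snd_one
  have h3 := (Represents.sumOfSquaresC (L := fun i => [i.nx, i.ny, i.nz]) h1 h2
    ((hx.mul_isBigO_u.add hy.mul_isBigO_u).add hz.mul_isBigO_u)).1
  exact h3.congr_err (((hx.sq_sub_isBigO.add hy.sq_sub_isBigO).add hz.sq_sub_isBigO).congr_left
    fun i => by ring)

theorem represents_D (hl : l ≤ awayFromPole B) :
    Represents l Run.D (fun i => (i.n 0 ^ 2 + i.n 1 ^ 2 + i.n 2 ^ 2) * i.z₀ ^ 2) := by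
  have hS := represents_S₃ (l := l) (B := B)
  have hC := represents_twoProd (z₀_isBigO_one hl) (z₀_isBigO_one hl)
  have h1 := (((represents_twoProd hS.fst hC.fst).compDotStep hS.fst hC.snd_one).compDotStep
    hS.snd_one hC.fst).compDotStep hS.snd_one hC.snd_one
  exact Represents.congr_err (P := Run.D) h1 ((hS.mul_err hC).congr_left fun i => by ring)

theorem E_aux (hl : l ≤ awayFromPole B) :
    (fun i => i.E.1) =O[l] (fun _ => (1 : ℝ)) ∧ Run.e =O[l] Run.u ∧
      (fun i => i.E.1 + i.e - i.s ^ 2) =O[l] fun i => i.u ^ 2 := by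
  have hS := represents_S₂ (l := l) (B := B)
  have hD := represents_D hl
  have hE : Represents l Run.E fun i => i.S₂.1 + -i.D.1 :=
    represents_twoSum hS.mem (fun i => neg_mem_floatSet (hD.mem i)) hS.fst hD.fst.neg_left
  have h1 := hS.snd.sub hD.snd
  have h2 := (fl_isBigO h1).add hE.snd
  refine ⟨hE.fst, fl_isBigO h2, (((fl_sub_self_isBigO_u_sq h2).add
    (fl_sub_self_isBigO_u_sq h1)).add (hE.err.add (hS.err.sub hD.err))).congr_left fun i => ?_⟩
  rw [i.s_sq, Run.e]
  ring

theorem E_add_e_sub_isBigO (hl : l ≤ awayFromPole B) :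
    (fun i => i.E.1 + i.e - i.s ^ 2) =O[l] fun i => i.u ^ 2 := (E_aux hl).2.2

theorem represents_T (hl : l ≤ awayFromPole B) : Represents l Run.T fun i => i.s ^ 2 :=
  (represents_fastTwoSum (E_aux hl).1 (E_aux hl).2.1).congr_err (E_add_e_sub_isBigO hl)

/-! ### Accuracy of the square root -/

theorem u_isLittleO_one (hl : l ≤ awayFromPole B) : Run.u =o[l] fun _ => (1 : ℝ) :=
  (u_isLittleO_N hl).trans_isBigO N_isBigO_one

theorem eventually_u_le (hl : l ≤ awayFromPole B) : ∀ᶠ i in l, i.u ≤ 1 / 8 := by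
  filter_upwards [(u_isLittleO_one hl).def (by norm_num : (0 : ℝ) < 1 / 8)] with i hi
  simpa [abs_of_pos i.u_pos] using hi

theorem Run.abs_le_two_mul_abs_fl (i : Run B) (hu : i.u ≤ 1 / 8) (t : ℝ) :
    |t| ≤ 2 * |i.fl t| := by
  have h1 := i.abs_fl_sub_le t
  have h2 := abs_sub_abs_le_abs_sub t (i.fl t)
  rw [abs_sub_comm] at h2
  nlinarith [abs_nonneg t]

theorem isBigO_fl (hl : l ≤ awayFromPole B) : f =O[l] fun i => i.fl (f i) :=
  .of_bound 2 (by
    filter_upwards [eventually_u_le hl] with i hi using i.abs_le_two_mul_abs_fl hi _)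

/-- The compensation term of `T` is `O(u T)` however small `T` is: if `E + e` suffers from
cancellation, then the sum is exact by Sterbenz' lemma and the compensation term vanishes. -/
theorem Run.abs_T_snd_le (i : Run B) : |i.T.2| ≤ 8 * (i.u * |i.E.1 + i.e|) := by
  have hu := i.u_pos
  have hu1 := i.u_le_one
  have hE : i.E.1 ∈ floatSet i.p := i.round.mem _
  have he : i.e ∈ floatSet i.p := i.round.mem _
  have hT : i.T.2 = i.fl (i.e - i.fl (i.fl (i.E.1 + i.e) - i.E.1)) := rfl
  rw [hT]
  generalize i.E.1 = E at *
  generalize i.e = e at *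
  by_cases hc : |E + e| ≤ |E| ∧ |E + e| ≤ |e|
  · rw [i.round.fl_eq (add_mem_floatSet_of_abs_le hE he hc.1 hc.2), add_sub_cancel_left,
      i.round.fl_eq he, sub_self, i.fl_zero, abs_zero]
    positivity
  have h0 : |e| ≤ 2 * |E + e| := by
    have : |e| ≤ |E + e| + |E| := by simpa using abs_sub (E + e) E
    rcases not_and_or.1 hc with hc | hc <;> linarith [abs_nonneg (E + e)]
  have h1 := i.abs_fl_sub_le (E + e)
  have h2 := i.abs_fl_sub_le (i.fl (E + e) - E)
  have h3 := i.abs_fl_sub_le (e - i.fl (i.fl (E + e) - E))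
  generalize i.fl (e - i.fl (i.fl (E + e) - E)) = t at *
  generalize i.fl (i.fl (E + e) - E) = z at *
  generalize i.fl (E + e) = x at *
  have h4 : |x - E| ≤ 3 * |E + e| := by
    have : |x - E| ≤ |x - (E + e)| + |e| := by
      calc _ = |x - (E + e) + e| := by congr 1; ring
        _ ≤ _ := abs_add_le _ _
    nlinarith [abs_nonneg (E + e)]
  have h5 : |e - z| ≤ 4 * (i.u * |E + e|) := by
    have : |e - z| ≤ |z - (x - E)| + |x - (E + e)| := by
      rw [← abs_neg]
      calc _ = |(z - (x - E)) + (x - (E + e))| := by congr 1; ring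
        _ ≤ _ := abs_add_le _ _
    nlinarith
  have h6 : |t| ≤ |t - (e - z)| + |e - z| := by simpa using abs_add_le (t - (e - z)) (e - z)
  nlinarith [abs_nonneg (e - z)]

theorem T_snd_isBigO (hl : l ≤ awayFromPole B) : (fun i => i.T.2) =O[l] fun i => i.u * i.T.1 := by
  have h1 : (fun i => i.T.2) =O[l] fun i => i.u * (i.E.1 + i.e) :=
    .of_bound 8 (.of_forall fun i => by
      simpa [abs_mul, abs_of_pos i.u_pos] using i.abs_T_snd_le)
  exact h1.trans ((isBigO_refl Run.u l).mul (isBigO_fl hl))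

theorem exists_abs_T_sub_le (hl : l ≤ awayFromPole B) :
    ∃ C, 0 ≤ C ∧ ∀ᶠ i in l, |i.T.1 - i.s ^ 2| ≤ i.u * i.s ^ 2 + C * i.u ^ 2 := by
  obtain ⟨C, hC, hb⟩ := (E_add_e_sub_isBigO hl).exists_pos
  refine ⟨2 * C, by positivity, ?_⟩
  filter_upwards [hb.bound] with i hi
  have h1 := i.abs_fl_sub_le (i.E.1 + i.e)
  rw [← i.T_fst] at h1
  simp only [Real.norm_eq_abs, abs_pow, sq_abs] at hi
  have h2 : |i.E.1 + i.e| ≤ |i.E.1 + i.e - i.s ^ 2| + i.s ^ 2 := by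
    calc _ = |i.E.1 + i.e - i.s ^ 2 + i.s ^ 2| := by congr 1; ring
      _ ≤ |i.E.1 + i.e - i.s ^ 2| + |i.s ^ 2| := abs_add_le _ _
      _ = _ := by rw [abs_of_nonneg (sq_nonneg i.s)]
  have h3 := abs_sub_le i.T.1 (i.E.1 + i.e) (i.s ^ 2)
  have hu := i.u_pos
  have hu1 := i.u_le_one
  have h4 : i.u * (C * i.u ^ 2) ≤ C * i.u ^ 2 := mul_le_of_le_one_left (by positivity) hu1
  nlinarith

/-- Along `awayFromPole`, the root of the computed radicand is within `O(u)` of `s`, even where the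
radicand has no correct digit. -/
theorem sqrt_T_sub_s_isBigO (hl : l ≤ awayFromPole B) (hT : ∀ᶠ i in l, 0 ≤ i.T.1) :
    (fun i => √i.T.1 - i.s) =O[l] Run.u := by
  obtain ⟨C, hC, hb⟩ := exists_abs_T_sub_le hl
  have h1 : (fun i => i.u * (1 + C + i.s)) =O[l] Run.u := by
    simpa using (isBigO_refl Run.u l).mul ((isBigO_const_const (1 + C) one_ne_zero l).add
      s_isBigO_one)
  refine (IsBigO.of_bound 1 ?_).trans h1
  filter_upwards [hb, hT] with i hi hTi
  have hu := i.u_pos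
  have hs := i.s_nonneg
  have hR := Real.sqrt_nonneg i.T.1
  rw [← Real.sq_sqrt hTi] at hi
  generalize √i.T.1 = R at *
  rw [Real.norm_eq_abs, one_mul, Real.norm_eq_abs,
    abs_of_nonneg (show 0 ≤ i.u * (1 + C + i.s) by positivity)]
  rw [show R ^ 2 - i.s ^ 2 = (R - i.s) * (R + i.s) by ring, abs_mul,
    abs_of_nonneg (by positivity : 0 ≤ R + i.s)] at hi
  rcases le_or_gt (R + i.s) i.u with hc | hc
  · have : |R - i.s| ≤ i.u := abs_le.2 ⟨by linarith, by linarith⟩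
    nlinarith [mul_nonneg hu.le (add_nonneg hC hs)]
  · have h2 : 0 < R + i.s := hu.trans hc
    refine le_of_mul_le_mul_right (hi.trans ?_) h2
    have h3 : i.u * i.s ^ 2 ≤ i.u * i.s * (R + i.s) := by nlinarith [mul_nonneg hu.le hs]
    have h4 : C * i.u ^ 2 ≤ C * i.u * (R + i.s) := by nlinarith [mul_nonneg hC hu.le]
    nlinarith [mul_pos hu h2]

theorem sqrt_T_isBigO_one (hl : l ≤ awayFromPole B) (hT : ∀ᶠ i in l, 0 ≤ i.T.1) :
    (fun i => √i.T.1) =O[l] fun _ => (1 : ℝ) := by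
  simpa using ((sqrt_T_sub_s_isBigO hl hT).trans u_isBigO_one).add s_isBigO_one

theorem root_fst_sub_isBigO :
    (fun i : Run B => i.root.1 - √i.T.1) =O[l] fun i => i.u * √i.T.1 :=
  fl_sub_isBigO (isBigO_refl _ l)

theorem root_fst_isBigO : (fun i : Run B => i.root.1) =O[l] fun i => √i.T.1 :=
  fl_isBigO (isBigO_refl _ l)

theorem isBigO_root_fst (hl : l ≤ awayFromPole B) : (fun i => √i.T.1) =O[l] fun i => i.root.1 :=
  isBigO_fl hl

/-- The residual, which is `O(u T)`, agrees with `T + t - P²` up to `O(u² T)`. The exactness of the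
subtraction `T - H` is not needed, as its result is already `O(u T)`. -/
theorem residual_aux (hl : l ≤ awayFromPole B) (hT : ∀ᶠ i in l, 0 ≤ i.T.1) :
    (fun i => i.residual) =O[l] (fun i => i.u * √i.T.1 ^ 2) ∧
    (fun i => i.residual - (i.T.1 + i.T.2 - i.root.1 ^ 2)) =O[l]
      fun i => i.u * (i.u * √i.T.1 ^ 2) := by
  have hsq : ∀ᶠ i in l, √i.T.1 ^ 2 = i.T.1 := hT.mono fun i hi => Real.sq_sqrt hi
  have hP2 : (fun i : Run B => i.root.1 * i.root.1) =O[l] fun i => √i.T.1 ^ 2 := by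
    simpa only [sq] using root_fst_isBigO.mul root_fst_isBigO
  have h1 := fl_sub_isBigO hP2
  have h1' : (fun i => i.root.1 * i.root.1 - i.fl (i.root.1 * i.root.1)) =O[l]
      fun i => i.u * √i.T.1 ^ 2 := h1.neg_left.congr_left fun i => neg_sub _ _
  have h2 := fl_sub_isBigO h1'
  have h3 : (fun i => i.T.1 - i.fl (i.root.1 * i.root.1)) =O[l] fun i => i.u * √i.T.1 ^ 2 := by
    have h := ((root_fst_sub_isBigO (l := l) (B := B)).mul
      (root_fst_isBigO.add (isBigO_refl (fun i : Run B => √i.T.1) l))).congr_right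
      (g₂ := fun i => i.u * √i.T.1 ^ 2) fun i => by ring
    refine (h1'.sub h).congr' ?_ .rfl
    filter_upwards [hsq] with i hi
    linear_combination hi
  have h4 := fl_sub_isBigO h3
  have h5 := (fl_isBigO h3).sub (fl_isBigO h1')
  have h6 := fl_sub_isBigO h5
  have hT2 : (fun i => i.T.2) =O[l] fun i => i.u * √i.T.1 ^ 2 := by
    refine (T_snd_isBigO hl).congr' .rfl ?_
    filter_upwards [hsq] with i hi
    rw [hi]
  have h7 := (fl_isBigO h5).add hT2
  have h8 := fl_sub_isBigO h7
  exact ⟨fl_isBigO h7, ((((h8.add h6).add h4)).sub h2).congr_left fun i => by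
    simp only [Run.residual, Run.root, twoProd]; ring⟩

theorem inv_denom_isBigO (hl : l ≤ awayFromPole B) :
    (fun i => (i.fl (2 * i.root.1))⁻¹) =O[l] fun i => (√i.T.1)⁻¹ := by
  refine IsBigO.inv_rev ?_ (.of_forall fun i h0 => ?_)
  · refine (isBigO_root_fst hl).trans (IsBigO.trans ?_ (isBigO_fl hl))
    exact (isBigO_refl _ l).const_mul_right two_ne_zero
  · simp [Run.root, h0, i.fl_zero]

theorem sq_mul_inv_self (x : ℝ) : x ^ 2 * x⁻¹ = x := by
  rcases eq_or_ne x 0 with rfl | h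
  · simp
  · field_simp

theorem quotient_isBigO (hl : l ≤ awayFromPole B) (hT : ∀ᶠ i in l, 0 ≤ i.T.1) :
    (fun i => i.residual / i.fl (2 * i.root.1)) =O[l] fun i => i.u * √i.T.1 := by
  refine ((residual_aux hl hT).1.mul (inv_denom_isBigO hl)).congr (fun i => ?_) fun i => ?_
  · rw [div_eq_mul_inv]
  · rw [mul_assoc, sq_mul_inv_self]

theorem root_snd_isBigO (hl : l ≤ awayFromPole B) (hT : ∀ᶠ i in l, 0 ≤ i.T.1) :
    (fun i => i.root.2) =O[l] fun i => i.u * √i.T.1 :=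
  fl_isBigO (quotient_isBigO hl hT)

theorem root_snd_isBigO_u (hl : l ≤ awayFromPole B) (hT : ∀ᶠ i in l, 0 ≤ i.T.1) :
    (fun i => i.root.2) =O[l] Run.u := by
  simpa using (root_snd_isBigO hl hT).trans ((isBigO_refl Run.u l).mul (sqrt_T_isBigO_one hl hT))

theorem root_fst_sub_s_isBigO (hl : l ≤ awayFromPole B) (hT : ∀ᶠ i in l, 0 ≤ i.T.1) :
    (fun i => i.root.1 - i.s) =O[l] Run.u := by
  have h1 : (fun i : Run B => i.root.1 - √i.T.1) =O[l] Run.u := by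
    simpa using root_fst_sub_isBigO.trans ((isBigO_refl Run.u l).mul (sqrt_T_isBigO_one hl hT))
  simpa using h1.add (sqrt_T_sub_s_isBigO hl hT)

theorem root_sub_s_isBigO (hl : l ≤ awayFromPole B) (hT : ∀ᶠ i in l, 0 ≤ i.T.1) :
    (fun i => i.root.1 + i.root.2 - i.s) =O[l] Run.u :=
  ((root_fst_sub_s_isBigO hl hT).add (root_snd_isBigO_u hl hT)).congr_left fun i => by ring

theorem eventually_T_ge (hl : l ≤ transversal B) : ∀ᶠ i in l, i.s ^ 2 / 4 ≤ i.T.1 := by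
  have hl' := hl.trans transversal_le
  obtain ⟨C, hC, hb⟩ := exists_abs_T_sub_le hl'
  have h1 : (fun i => i.u ^ 2) =o[l] fun i => i.s ^ 2 := (u_isLittleO_s hl).pow two_pos
  filter_upwards [hb, h1.def (show 0 < 1 / (4 * (C + 1)) by positivity), eventually_u_le hl']
    with i hi h2 h3
  simp only [Real.norm_eq_abs, abs_pow, sq_abs] at h2
  have h4 : C * i.u ^ 2 ≤ i.s ^ 2 / 4 := by
    rw [div_mul_eq_mul_div, one_mul, le_div_iff₀ (by positivity)] at h2
    nlinarith [sq_nonneg i.u]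
  nlinarith [(abs_le.1 hi).1, sq_nonneg i.s]

theorem eventually_T_nonneg (hl : l ≤ transversal B) : ∀ᶠ i in l, 0 ≤ i.T.1 :=
  (eventually_T_ge hl).mono fun i hi => (by positivity : 0 ≤ i.s ^ 2 / 4).trans hi

theorem s_isBigO_sqrt_T (hl : l ≤ transversal B) : Run.s =O[l] fun i => √i.T.1 :=
  .of_bound 2 (by
    filter_upwards [eventually_T_ge hl] with i hi
    rw [Real.norm_of_nonneg i.s_nonneg, Real.norm_of_nonneg (Real.sqrt_nonneg _)]
    have : i.s / 2 ≤ √i.T.1 := Real.le_sqrt_of_sq_le (by linarith)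
    linarith)

/-- Along `transversal`, the compensated root is a Newton correction of its leading part: with
`P - s = O(u)`, the error of `P + (T + t - P²) / (2 P)` is
`((P - s)² + (T + t - s²)) / (2 P) = O(u² / s)`. -/
theorem root_sub_s_isBigO_of_transversal (hl : l ≤ transversal B) :
    (fun i => i.root.1 + i.root.2 - i.s) =O[l] fun i => i.u ^ 2 / i.s := by
  have hl' := hl.trans transversal_le
  have hT := eventually_T_nonneg hl
  have hs := eventually_s_pos hl
  have hR0 : ∀ᶠ i in l, √i.T.1 ≠ 0 := by
    filter_upwards [eventually_T_ge hl, hs] with i h1 h2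
    exact (Real.sqrt_pos.2 ((by positivity : 0 < i.s ^ 2 / 4).trans_le h1)).ne'
  have hP0 : ∀ᶠ i in l, i.root.1 ≠ 0 := by
    filter_upwards [hR0, eventually_u_le hl'] with i h1 h2 h0
    have h3 := i.abs_le_two_mul_abs_fl h2 (√i.T.1)
    rw [show i.fl (√i.T.1) = 0 from h0, abs_zero, mul_zero] at h3
    exact h1 (abs_eq_zero.1 (le_antisymm h3 (abs_nonneg _)))
  have hq0 : ∀ᶠ i in l, i.fl (2 * i.root.1) ≠ 0 := by
    filter_upwards [hP0, eventually_u_le hl'] with i h1 h2 h0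
    have h3 := i.abs_le_two_mul_abs_fl h2 (2 * i.root.1)
    rw [h0, abs_zero, mul_zero] at h3
    exact h1 (by simpa using abs_eq_zero.1 (le_antisymm h3 (abs_nonneg _)))
  have hPinv : (fun i => (2 * i.root.1)⁻¹) =O[l] fun i => i.s⁻¹ := by
    refine IsBigO.inv_rev ?_ (hs.mono fun i hi h0 => absurd h0 hi.ne')
    exact ((s_isBigO_sqrt_T hl).trans (isBigO_root_fst hl')).const_mul_right two_ne_zero
  obtain ⟨hr1, hr2⟩ := residual_aux hl' hT
  -- second-order terms relative to `√T` are `O(u² / s)`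
  have huR : (fun i => i.u * (i.u * √i.T.1)) =O[l] fun i => i.u ^ 2 / i.s := by
    have h1 : (fun i => i.s) =O[l] fun i => i.s⁻¹ := by
      refine ((s_isBigO_one.mul s_isBigO_one).mul (isBigO_refl (fun i => i.s⁻¹) l)).congr'
        ?_ (.of_forall fun i => by ring)
      filter_upwards [hs] with i hi
      field_simp
    have h2 : (fun i => √i.T.1) =O[l] fun i => i.s⁻¹ := by
      have h3 : (fun i => i.u) =O[l] fun i => i.s⁻¹ := (u_isLittleO_s hl).isBigO.trans h1
      simpa using ((sqrt_T_sub_s_isBigO hl' hT).trans h3).add h1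
    exact ((isBigO_refl (fun i => i.u ^ 2) l).mul h2).congr (fun i => by ring) fun i => by
      rw [div_eq_mul_inv]
  have hPinv' : (fun i => (2 * i.root.1)⁻¹) =O[l] fun i => (√i.T.1)⁻¹ :=
    IsBigO.inv_rev ((isBigO_root_fst hl').const_mul_right two_ne_zero)
      (hR0.mono fun i hi h0 => absurd h0 hi)
  have e1 := fl_sub_isBigO (quotient_isBigO hl' hT)
  have e2 : (fun i => i.residual * ((2 * i.root.1 - i.fl (2 * i.root.1)) *
      ((i.fl (2 * i.root.1))⁻¹ * (2 * i.root.1)⁻¹))) =O[l] fun i => i.u * (i.u * √i.T.1) := by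
    have h1 : (fun i => 2 * i.root.1 - i.fl (2 * i.root.1)) =O[l] fun i => i.u * √i.T.1 :=
      (fl_sub_isBigO (root_fst_isBigO.const_mul_left 2)).neg_left.congr_left fun i => neg_sub _ _
    refine (hr1.mul (h1.mul ((inv_denom_isBigO hl').mul hPinv'))).congr' .rfl ?_
    filter_upwards [hR0] with i hi
    field_simp
  have e3 : (fun i => (i.residual - (i.T.1 + i.T.2 - i.root.1 ^ 2)) * (2 * i.root.1)⁻¹) =O[l]
      fun i => i.u * (i.u * √i.T.1) := by
    refine (hr2.mul hPinv').congr' .rfl ?_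
    filter_upwards [hR0] with i hi
    field_simp
  have e4 : (fun i => ((i.root.1 - i.s) ^ 2 + (i.T.1 + i.T.2 - i.s ^ 2)) * (2 * i.root.1)⁻¹)
      =O[l] fun i => i.u ^ 2 / i.s :=
    (((root_fst_sub_s_isBigO hl' hT).pow 2).add (represents_T hl').err).mul hPinv
      |>.congr_right fun i => by rw [div_eq_mul_inv]
  refine ((((e1.add e2).add e3).trans huR).add e4).congr' ?_ .rfl
  filter_upwards [hP0, hq0] with i h1 h2
  have h3 : i.root.2 = i.fl (i.residual / i.fl (2 * i.root.1)) := rfl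
  rw [h3]
  field_simp
  ring

/-! ### Accuracy of the coordinates -/

/-- The error of a numerator before its final rounding, when the pair for `s` has an error
`O(h)`. -/
theorem numer_sub_isBigO (hl : l ≤ awayFromPole B) (hT : ∀ᶠ i in l, 0 ≤ i.T.1)
    (hη : (fun i => i.root.1 + i.root.2 - i.s) =O[l] h)
    (hh : (fun i => i.u ^ 2) =O[l] fun i => i.N * h i)
    (hP : Represents l P α) (hQ : Represents l Q β) (hβ : β =O[l] Run.N) :
    (fun i => (i.numer (P i) (Q i)).1 + (i.numer (P i) (Q i)).2 -
      (i.z₀ * α i * i.n 2 + i.s * β i)) =O[l] fun i => i.N * h i := by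
  have hz := z₀_isBigO_one hl
  have hF := hP.pairProd represents_nz
  have hr2 := (root_snd_isBigO_u hl hT).trans u_isBigO_one
  have hr1 : (fun i => i.root.1) =O[l] fun _ => (1 : ℝ) :=
    root_fst_isBigO.trans (sqrt_T_isBigO_one hl hT)
  have h1 := (((((represents_twoProd hF.fst hz).compDotStep hF.snd_one hz).compDotStep
    hQ.fst hr1).compDotStep hQ.snd_one hr1).compDotStep hQ.fst hr2).compDotStep hQ.snd_one hr2
  have h2 := hF.err.mul hz
  have h3 := hQ.err.mul (hr1.add hr2)
  simp only [mul_one] at h2 h3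
  refine ((((h1.err.add h2).add h3).trans hh).add (hβ.mul hη)).congr_left fun i => ?_
  simp only [Run.numer, compDotC, List.foldl]
  ring

theorem eventually_preS₂_ge (hl : l ≤ awayFromPole B) : ∀ᶠ i in l, i.N ^ 2 / 2 ≤ i.preS₂ := by
  have h1 : (fun i => i.preS₂ - i.N ^ 2) =o[l] fun i => i.N ^ 2 :=
    preS₂_sub_isBigO.trans_isLittleO ((u_isLittleO_N hl).pow two_pos)
  filter_upwards [h1.def (by norm_num : (0 : ℝ) < 1 / 2)] with i hi
  simp only [Real.norm_eq_abs, abs_pow, sq_abs] at hi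
  linarith [(abs_le.1 hi).1]

theorem eventually_preS₂_pos (hl : l ≤ awayFromPole B) : ∀ᶠ i in l, 0 < i.preS₂ := by
  filter_upwards [eventually_preS₂_ge hl, eventually_N_pos hl] with i h1 h2
  exact (by positivity : 0 < i.N ^ 2 / 2).trans_le h1

theorem numer_div_sub_isBigO (hl : l ≤ awayFromPole B) (hT : ∀ᶠ i in l, 0 ≤ i.T.1)
    (hη : (fun i => i.root.1 + i.root.2 - i.s) =O[l] h)
    (hh : (fun i => i.u ^ 2) =O[l] fun i => i.N * h i)
    (hP : Represents l P α) (hQ : Represents l Q β) (hβ : β =O[l] Run.N)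
    (hv : (fun i => (i.z₀ * α i * i.n 2 + i.s * β i) / i.N ^ 2) =O[l] fun _ => (1 : ℝ)) :
    (fun i => ((i.numer (P i) (Q i)).1 + (i.numer (P i) (Q i)).2) / i.preS₂ -
      (i.z₀ * α i * i.n 2 + i.s * β i) / i.N ^ 2) =O[l] fun i => h i / i.N := by
  have hN := eventually_N_pos hl
  have hinv : (fun i => i.preS₂⁻¹) =O[l] fun i => (i.N ^ 2)⁻¹ := by
    refine IsBigO.inv_rev (.of_bound 2 ?_) (hN.mono fun i hi h0 => absurd h0 (by positivity))
    filter_upwards [eventually_preS₂_ge hl] with i hi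
    rw [Real.norm_of_nonneg (sq_nonneg _), Real.norm_of_nonneg ((by positivity :
      0 ≤ i.N ^ 2 / 2).trans hi)]
    linarith
  have h1 := numer_sub_isBigO hl hT hη hh hP hQ hβ
  have h2 := hv.mul (preS₂_sub_isBigO.trans hh)
  simp only [one_mul] at h2
  refine ((h1.sub h2).mul hinv).congr' ?_ ?_
  · filter_upwards [hN, eventually_preS₂_pos hl] with i hi hi'
    field_simp
    ring
  · filter_upwards [hN] with i hi
    field_simp

/-- Rounding the numerator, the denominator and the quotient costs `3 u` to first order. -/
theorem Run.abs_coord_sub_le (i : Run B) (a b : ℝ × ℝ) (hu : i.u ≤ 1 / 8) (hS : 0 < i.preS₂) :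
    |i.coord a b - ((i.numer a b).1 + (i.numer a b).2) / i.preS₂| ≤
      (3 * i.u + 10 * i.u ^ 2) * |((i.numer a b).1 + (i.numer a b).2) / i.preS₂| := by
  have hu0 := i.u_pos
  rw [Run.coord, i.S₂_fst]
  generalize (i.numer a b).1 + (i.numer a b).2 = A
  generalize i.preS₂ = S at *
  have h1 := i.abs_fl_sub_le A
  have h2 := i.abs_fl_sub_le S
  have h3 := i.abs_fl_sub_le (i.fl A / i.fl S)
  generalize i.fl (i.fl A / i.fl S) = q at *
  generalize i.fl A = X at *
  generalize i.fl S = S' at *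
  rw [abs_of_pos hS] at h2
  have hS' : (1 - i.u) * S ≤ S' := by linarith [(abs_le.1 h2).1]
  have hS'0 : 0 < S' := lt_of_lt_of_le (mul_pos (by linarith) hS) hS'
  set y := |A| / S' with hy
  have hy0 : 0 ≤ y := by positivity
  have hyW : (1 - i.u) * y ≤ |A / S| := by
    rw [abs_div, abs_of_pos hS, hy, le_div_iff₀ hS, mul_div_assoc', div_mul_eq_mul_div,
      div_le_iff₀ hS'0]
    nlinarith [abs_nonneg A]
  have h4 : |X / S' - A / S| ≤ 2 * i.u * y := by
    have e : X / S' - A / S = ((X - A) - A / S * (S' - S)) / S' := by field_simp; ring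
    rw [e, abs_div, abs_of_pos hS'0, hy, mul_div_assoc']
    gcongr
    refine (abs_sub _ _).trans ?_
    rw [abs_mul, abs_div, abs_of_pos hS]
    have : |A| / S * |S' - S| ≤ |A| / S * (i.u * S) := by gcongr
    have e2 : |A| / S * (i.u * S) = i.u * |A| := by field_simp
    linarith
  have h5 : |X / S'| ≤ (1 + i.u) * y := by
    have : |X| ≤ |X - A| + |A| := by simpa using abs_add_le (X - A) A
    rw [abs_div, abs_of_pos hS'0, hy, mul_div_assoc']
    gcongr
    linarith
  have h6 := abs_sub_le q (X / S') (A / S)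
  have h7 : |q - A / S| ≤ (3 * i.u + i.u ^ 2) * y := by nlinarith
  have h8 : (3 * i.u + i.u ^ 2) * y ≤ (3 * i.u + 10 * i.u ^ 2) * ((1 - i.u) * y) := by
    have : 3 * i.u + i.u ^ 2 ≤ (3 * i.u + 10 * i.u ^ 2) * (1 - i.u) := by
      nlinarith [mul_pos hu0 hu0]
    nlinarith
  exact h7.trans (h8.trans (by gcongr))

theorem exists_abs_coord_sub_le (hl : l ≤ awayFromPole B) (hT : ∀ᶠ i in l, 0 ≤ i.T.1)
    (h0 : ∀ i, 0 ≤ h i) (hη : (fun i => i.root.1 + i.root.2 - i.s) =O[l] h)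
    (hh : (fun i => i.u ^ 2) =O[l] fun i => i.N * h i)
    (hP : Represents l P α) (hQ : Represents l Q β) (hβ : β =O[l] Run.N)
    (hv : ∀ i, v i = (i.z₀ * α i * i.n 2 + i.s * β i) / i.N ^ 2)
    (hv1 : ∀ᶠ i in l, |v i| ≤ 1) :
    ∃ K, 0 < K ∧ ∀ᶠ i in l, |i.coord (P i) (Q i) - v i| ≤ 3 * i.u * |v i| + K * (h i / i.N) := by
  have hvO : v =O[l] fun _ => (1 : ℝ) := .of_bound 1 (by simpa using hv1)
  obtain rfl : v = _ := funext hv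
  obtain ⟨C, hC, hb⟩ := (numer_div_sub_isBigO hl hT hη hh hP hQ hβ hvO).exists_pos
  have hu2 : (fun i => i.u ^ 2) =O[l] fun i => h i / i.N := by
    have h1 := hh.trans (((N_isBigO_one.mul N_isBigO_one).mul
      (isBigO_refl (fun i => h i / i.N) l)).congr' (f₂ := fun i => i.N * h i) (by
        filter_upwards [eventually_N_pos hl] with i hi
        field_simp) .rfl)
    simpa using h1
  obtain ⟨C', hC', hb'⟩ := hu2.exists_pos
  refine ⟨2 * C + 10 * C', by positivity, ?_⟩
  filter_upwards [hb.bound, hb'.bound, hv1, eventually_u_le hl, eventually_preS₂_pos hl]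
    with i h1 h2 h3 h4 h5
  have hq := i.abs_coord_sub_le (P i) (Q i) h4 h5
  have hu := i.u_pos
  have hN : 0 ≤ h i / i.N := div_nonneg (h0 i) i.N_nonneg
  rw [Real.norm_of_nonneg hN, Real.norm_eq_abs] at h1
  rw [Real.norm_of_nonneg hN, Real.norm_of_nonneg (by positivity)] at h2
  generalize (i.z₀ * α i * i.n 2 + i.s * β i) / i.N ^ 2 = V at *
  generalize ((i.numer (P i) (Q i)).1 + (i.numer (P i) (Q i)).2) / i.preS₂ = W at *
  have h6 := abs_sub_le (i.coord (P i) (Q i)) W V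
  have h7 : |W| ≤ |W - V| + |V| := by simpa using abs_add_le (W - V) V
  have h8 : (3 * i.u + 10 * i.u ^ 2) * |W| ≤ (3 * i.u + 10 * i.u ^ 2) * (|W - V| + |V|) := by
    gcongr
  have h9 : (3 * i.u + 10 * i.u ^ 2) * |W - V| ≤ 1 * |W - V| := by
    gcongr; nlinarith
  have h10 : 10 * i.u ^ 2 * |V| ≤ 10 * i.u ^ 2 * 1 := by gcongr
  linarith

theorem norm_sub_le_of_coord {P : EuclideanSpace ℝ (Fin 3)} {R : ℝ × ℝ} {z c d : ℝ}
    (hP : ‖P‖ = 1) (hz : P 2 = z) (hc : 0 ≤ c) (hd : 0 ≤ d)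
    (h0 : |R.1 - P 0| ≤ c * |P 0| + d) (h1 : |R.2 - P 1| ≤ c * |P 1| + d) :
    ‖!₂[R.1, R.2, z] - P‖ ≤ c * √(1 - z ^ 2) + 2 * d := by
  have hs : P 0 ^ 2 + P 1 ^ 2 + z ^ 2 = 1 := by
    have : ‖P‖ ^ 2 = 1 := by rw [hP, one_pow]
    simpa [EuclideanSpace.norm_sq_eq, Fin.sum_univ_three, hz] using this
  have hn : ‖!₂[R.1, R.2, z] - P‖ ^ 2 = (R.1 - P 0) ^ 2 + (R.2 - P 1) ^ 2 := by
    simp [EuclideanSpace.norm_sq_eq, Fin.sum_univ_three, hz]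
  have hr := Real.sq_sqrt (by nlinarith [sq_nonneg (P 0), sq_nonneg (P 1)] : 0 ≤ 1 - z ^ 2)
  have hr0 := Real.sqrt_nonneg (1 - z ^ 2)
  generalize √(1 - z ^ 2) = r at *
  apply le_of_sq_le_sq _ (by positivity)
  rw [hn]
  have e0 := pow_le_pow_left₀ (abs_nonneg _) h0 2
  have e1 := pow_le_pow_left₀ (abs_nonneg _) h1 2
  rw [sq_abs] at e0 e1
  have hx := sq_abs (P 0)
  have hy := sq_abs (P 1)
  have hx0 : |P 0| ≤ r := abs_le_of_sq_le_sq (by nlinarith [sq_nonneg (P 1)]) hr0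
  have hy0 : |P 1| ≤ r := abs_le_of_sq_le_sq (by nlinarith [sq_nonneg (P 0)]) hr0
  have hcd := mul_nonneg hc hd
  have hxy : |P 0| ^ 2 + |P 1| ^ 2 = r ^ 2 := by linarith
  have e2 : c * d * (|P 0| + |P 1|) ≤ c * d * (2 * r) := by gcongr; linarith
  have e3 : c ^ 2 * (|P 0| ^ 2 + |P 1| ^ 2) = c ^ 2 * r ^ 2 := by rw [hxy]
  nlinarith [sq_nonneg d]

/-- If the pair for `s` has an error `O(h)`, then a result exists, and its error is bounded by the
three final roundings and by `O(h / ‖n_xy‖)`. -/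
theorem exists_norm_sub_le (hl : l ≤ awayFromPole B) (hT : ∀ᶠ i in l, 0 ≤ i.T.1)
    (h0 : ∀ i, 0 ≤ h i) (hη : (fun i => i.root.1 + i.root.2 - i.s) =O[l] h)
    (hh : (fun i => i.u ^ 2) =O[l] fun i => i.N * h i) :
    ∃ K, 0 < K ∧ ∀ᶠ i in l, ∃ R : ℝ × ℝ, accuX i.fl i.x₁ i.x₂ i.z₀ = some R ∧
      ‖!₂[R.1, R.2, i.z₀] - exactPoint i.x₁ i.x₂ i.z₀‖ ≤
        3 * √(1 - i.z₀ ^ 2) * i.u + K * (h i / i.N) := by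
  have hspec : ∀ᶠ i in l, ‖exactPoint i.x₁ i.x₂ i.z₀‖ = 1 ∧
      exactPoint i.x₁ i.x₂ i.z₀ 2 = i.z₀ := by
    filter_upwards [eventually_N_pos hl] with i hi
    exact (exactPoint_spec _ _ _ (norm_pos_iff.1 hi) i.input.exists_inter).2
  have hle (j : Fin 3) : ∀ᶠ i in l, |-(exactPoint i.x₁ i.x₂ i.z₀ j)| ≤ 1 := by
    filter_upwards [hspec] with i hi
    rw [abs_neg]
    exact (PiLp.norm_apply_le (exactPoint i.x₁ i.x₂ i.z₀) j).trans hi.1.le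
  obtain ⟨K₁, hK₁, hx⟩ := exists_abs_coord_sub_le hl hT h0 hη hh represents_nx represents_ny
    n_one_isBigO_N (v := fun i => -(exactPoint i.x₁ i.x₂ i.z₀ 0))
    (fun i => by simp [exactPoint, Run.n, Run.s, Run.N]) (hle 0)
  obtain ⟨K₂, hK₂, hy⟩ := exists_abs_coord_sub_le hl hT h0 hη hh represents_ny represents_nx.neg
    n_zero_isBigO_N.neg_left (v := fun i => -(exactPoint i.x₁ i.x₂ i.z₀ 1))
    (fun i => by simp [exactPoint, Run.n, Run.s, Run.N, sub_eq_add_neg]) (hle 1)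
  refine ⟨2 * (K₁ + K₂), by positivity, ?_⟩
  filter_upwards [hx, hy, hspec, hT, eventually_u_le hl, eventually_preS₂_pos hl]
    with i hx hy hs hT hu hS
  have hS0 : i.S₂.1 ≠ 0 := fun hc => by
    have := i.abs_le_two_mul_abs_fl hu i.preS₂
    rw [← i.S₂_fst, hc, abs_zero, mul_zero, abs_of_pos hS] at this
    linarith
  refine ⟨_, i.accuX_eq_some hT hS0, ?_⟩
  have hN : 0 ≤ h i / i.N := div_nonneg (h0 i) i.N_nonneg
  have h1 : K₁ * (h i / i.N) ≤ (K₁ + K₂) * (h i / i.N) := by gcongr; linarith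
  have h2 : K₂ * (h i / i.N) ≤ (K₁ + K₂) * (h i / i.N) := by gcongr; linarith
  have hu0 := i.u_pos
  rw [abs_neg, sub_neg_eq_add, ← abs_neg, neg_add, ← sub_eq_add_neg] at hx hy
  refine (norm_sub_le_of_coord hs.1 hs.2 (by positivity : 0 ≤ 3 * i.u)
    (by positivity : 0 ≤ (K₁ + K₂) * (h i / i.N)) (hx.trans (by linarith))
    (hy.trans (by linarith))).trans_eq (by ring)

/-! ### The two regimes -/

theorem exists_transversal_bound (B : ℝ) : ∃ K L : ℝ, 0 < K ∧ 0 < L ∧ ∀ i : Run B,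
    L * i.u ≤ i.s → ∃ R : ℝ × ℝ, accuX i.fl i.x₁ i.x₂ i.z₀ = some R ∧
      ‖!₂[R.1, R.2, i.z₀] - exactPoint i.x₁ i.x₂ i.z₀‖ ≤
        3 * √(1 - i.z₀ ^ 2) * i.u + K / (i.s * i.N) * i.u ^ 2 := by
  have hu2 : (fun i => i.u ^ 2) =O[transversal B] fun i => i.N * (i.u ^ 2 / i.s) := by
    refine ((s_isBigO_N.mul (isBigO_refl (fun i => i.u ^ 2 / i.s) _))).congr' ?_ .rfl
    filter_upwards [eventually_s_pos le_rfl] with i hi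
    field_simp
  obtain ⟨K, hK, hb⟩ := exists_norm_sub_le transversal_le (eventually_T_nonneg le_rfl)
    (fun i => div_nonneg (sq_nonneg _) i.s_nonneg)
    (root_sub_s_isBigO_of_transversal le_rfl) hu2
  rw [transversal, eventually_comap, eventually_atTop] at hb
  obtain ⟨L, hL⟩ := hb
  refine ⟨K, max L 1, hK, by positivity, fun i hi => ?_⟩
  obtain ⟨R, hR, hle⟩ := hL _ ((le_max_left L 1).trans ((le_div_iff₀ i.u_pos).2 hi)) i rfl
  refine ⟨R, hR, hle.trans_eq ?_⟩
  congr 1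
  rw [div_div, mul_div_assoc', div_mul_eq_mul_div]

theorem exists_awayFromPole_bound (B : ℝ) : ∃ K L : ℝ, 0 < K ∧ 0 < L ∧ ∀ i : Run B,
    L * i.u ≤ i.N → ∀ R : ℝ × ℝ, accuX i.fl i.x₁ i.x₂ i.z₀ = some R →
      ‖!₂[R.1, R.2, i.z₀] - exactPoint i.x₁ i.x₂ i.z₀‖ ≤ K / i.N * i.u := by
  let l := awayFromPole B ⊓ 𝓟 {i | 0 ≤ i.T.1}
  have hl : l ≤ awayFromPole B := inf_le_left
  have hT : ∀ᶠ i in l, 0 ≤ i.T.1 := mem_inf_of_right (mem_principal_self _)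
  have hu2 : (fun i => i.u ^ 2) =O[l] fun i => i.N * i.u := by
    simpa [sq] using (u_isLittleO_N hl).isBigO.mul (isBigO_refl Run.u l)
  obtain ⟨K, hK, hb⟩ := exists_norm_sub_le hl hT (fun i => i.u_pos.le)
    (root_sub_s_isBigO hl hT) hu2
  obtain ⟨C, hC, hN⟩ := (N_isBigO_one (l := l)).exists_pos
  have h1 : ∀ᶠ i in l, ∀ R : ℝ × ℝ, accuX i.fl i.x₁ i.x₂ i.z₀ = some R →
      ‖!₂[R.1, R.2, i.z₀] - exactPoint i.x₁ i.x₂ i.z₀‖ ≤ (3 * C + K) / i.N * i.u := by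
    filter_upwards [hb, hN.bound, eventually_N_pos hl] with i ⟨R', hR', hle⟩ h2 h3 R hR
    obtain rfl : R' = R := by rw [hR'] at hR; exact Option.some.inj hR
    have h4 : √(1 - i.z₀ ^ 2) ≤ 1 := Real.sqrt_le_one.2 (by nlinarith [sq_nonneg i.z₀])
    simp only [Real.norm_eq_abs, abs_of_pos h3, abs_one, mul_one] at h2
    have hu := i.u_pos
    refine hle.trans ?_
    have h5 : 3 * √(1 - i.z₀ ^ 2) * i.u ≤ 3 * C / i.N * i.u := by
      gcongr
      rw [le_div_iff₀ h3]
      nlinarith [Real.sqrt_nonneg (1 - i.z₀ ^ 2)]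
    calc _ ≤ 3 * C / i.N * i.u + K * (i.u / i.N) := by gcongr
      _ = _ := by ring
  rw [eventually_inf_principal, awayFromPole, eventually_comap, eventually_atTop] at h1
  obtain ⟨L, hL⟩ := h1
  refine ⟨3 * C + K, max L 1, by positivity, by positivity, fun i hi R hR => ?_⟩
  exact hL _ ((le_max_left L 1).trans ((le_div_iff₀ i.u_pos).2 hi)) i rfl
    (i.T_nonneg_of_accuX_eq_some hR) R hR

theorem exists_le_unitRoundoff_rpow_neg {c : ℝ} (hc : 0 < c) (L : ℝ) :
    ∃ p₀ : ℕ, ∀ p, p₀ ≤ p → L ≤ unitRoundoff p ^ (-c) := by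
  have h := (tendsto_pow_atTop_atTop_of_one_lt
    (Real.one_lt_rpow (one_lt_two (α := ℝ)) hc)).eventually_ge_atTop L
  obtain ⟨p₀, hp₀⟩ := eventually_atTop.1 h
  refine ⟨p₀, fun p hp => (hp₀ p hp).trans_eq ?_⟩
  rw [unitRoundoff, ← Real.rpow_intCast, ← Real.rpow_mul zero_le_two, ← Real.rpow_natCast,
    ← Real.rpow_mul zero_le_two]
  congr 1
  push_cast
  ring

end AccuX

theorem mainTheorem1 (B : ℝ) :
    -- regime (ii): the first-order coefficient is `3 √(1 - z₀²)`
    (∃ K : ℝ, 0 < K ∧ ∀ c : ℝ, 0 < c → ∃ p₀ : ℕ, ∀ p : ℕ, p₀ ≤ p →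
      ∀ fl : ℝ → ℝ, AccuX.IsRoundToNearest p fl →
      ∀ (x₁ x₂ : EuclideanSpace ℝ (Fin 3)) (z₀ : ℝ), AccuX.IsInput p B x₁ x₂ z₀ →
      AccuX.unitRoundoff p ^ (1 - c) < AccuX.sVal x₁ x₂ z₀ →
      ∃ R : ℝ × ℝ, AccuX.accuX fl x₁ x₂ z₀ = some R ∧
        ‖!₂[R.1, R.2, z₀] - AccuX.exactPoint x₁ x₂ z₀‖ ≤
          3 * √(1 - z₀ ^ 2) * AccuX.unitRoundoff p +
            K / (AccuX.sVal x₁ x₂ z₀ * ‖AccuX.normalXY x₁ x₂‖) * AccuX.unitRoundoff p ^ 2 ∧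
        ‖!₂[R.1, R.2, z₀] - AccuX.exactPoint x₁ x₂ z₀‖ ≤
          3 * AccuX.unitRoundoff p +
            K / ‖AccuX.normalXY x₁ x₂‖ * AccuX.unitRoundoff p ^ (1 + c)) ∧
    -- regime (i): no condition on `s`; the first-order coefficient depends on `‖n_xy‖`
    (∃ K L : ℝ, 0 < K ∧ 0 < L ∧ ∀ p : ℕ,
      ∀ fl : ℝ → ℝ, AccuX.IsRoundToNearest p fl →
      ∀ (x₁ x₂ : EuclideanSpace ℝ (Fin 3)) (z₀ : ℝ), AccuX.IsInput p B x₁ x₂ z₀ →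
      L * AccuX.unitRoundoff p ≤ ‖AccuX.normalXY x₁ x₂‖ →
      (L * AccuX.unitRoundoff p ≤ AccuX.sVal x₁ x₂ z₀ →
        ∃ R : ℝ × ℝ, AccuX.accuX fl x₁ x₂ z₀ = some R) ∧
      ∀ R : ℝ × ℝ, AccuX.accuX fl x₁ x₂ z₀ = some R →
        ‖!₂[R.1, R.2, z₀] - AccuX.exactPoint x₁ x₂ z₀‖ ≤
          K / ‖AccuX.normalXY x₁ x₂‖ * AccuX.unitRoundoff p) := by
  obtain ⟨K, L, hK, hL, hb⟩ := AccuX.exists_transversal_bound B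
  obtain ⟨K', L', hK', hL', hb'⟩ := AccuX.exists_awayFromPole_bound B
  refine ⟨⟨K, hK, fun c hc => ?_⟩, K', max L L', hK', lt_max_of_lt_left hL,
    fun p fl hfl x₁ x₂ z₀ hin hN => ⟨fun hs => ?_, fun R hR => ?_⟩⟩
  · obtain ⟨p₀, hp₀⟩ := AccuX.exists_le_unitRoundoff_rpow_neg hc L
    refine ⟨p₀, fun p hp fl hfl x₁ x₂ z₀ hin hs => ?_⟩
    let i : AccuX.Run B := ⟨p, fl, x₁, x₂, z₀, hfl, hin⟩
    have hu : 0 < AccuX.unitRoundoff p := i.u_pos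
    have hLs : L * i.u ≤ i.s := by
      refine le_trans ?_ hs.le
      rw [sub_eq_neg_add, Real.rpow_add hu, Real.rpow_one]
      exact mul_le_mul_of_nonneg_right (hp₀ p hp) hu.le
    obtain ⟨R, hR, hle⟩ := hb i hLs
    refine ⟨R, hR, hle, hle.trans ?_⟩
    have h1 : √(1 - z₀ ^ 2) ≤ 1 := Real.sqrt_le_one.2 (by nlinarith [sq_nonneg z₀])
    have hs0 : 0 < AccuX.sVal x₁ x₂ z₀ := (by positivity : (0 : ℝ) < _).trans hs
    have hN0 : 0 < ‖AccuX.normalXY x₁ x₂‖ := hs0.trans_le i.s_le_N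
    have h2 : AccuX.unitRoundoff p ^ 2 ≤
        AccuX.sVal x₁ x₂ z₀ * AccuX.unitRoundoff p ^ (1 + c) := by
      calc AccuX.unitRoundoff p ^ 2
          = AccuX.unitRoundoff p ^ (1 - c) * AccuX.unitRoundoff p ^ (1 + c) := by
            rw [← Real.rpow_add hu, ← Real.rpow_natCast]; norm_num
        _ ≤ _ := by gcongr
    change 3 * √(1 - z₀ ^ 2) * AccuX.unitRoundoff p +
      K / (AccuX.sVal x₁ x₂ z₀ * ‖AccuX.normalXY x₁ x₂‖) * AccuX.unitRoundoff p ^ 2 ≤ _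
    refine add_le_add (by nlinarith) ?_
    rw [div_mul_eq_mul_div, div_mul_eq_mul_div, div_le_div_iff₀ (by positivity) hN0]
    have := mul_le_mul_of_nonneg_left h2 (mul_pos hK hN0).le
    linarith
  · obtain ⟨R, hR, -⟩ := hb ⟨p, fl, x₁, x₂, z₀, hfl, hin⟩
      ((mul_le_mul_of_nonneg_right (le_max_left L L') (AccuX.unitRoundoff_pos p).le).trans hs)
    exact ⟨R, hR⟩
  · exact hb' ⟨p, fl, x₁, x₂, z₀, hfl, hin⟩
      ((mul_le_mul_of_nonneg_right (le_max_right L L') (AccuX.unitRoundoff_pos p).le).trans hN)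
      R hR
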